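/- A *dynamical system* $(X,T)$ is a compact metrizable space $X$ with a homeomorphism $T:X\to X$. A *factor map* $\pi:(X,T)\to(Y,S)$ is a continuous surjection $\pi:X\to Y$ with $\pi\circ T=S\circ\pi$. For a metric $d$ on a space $A$, a continuous map $f$ from $A$ to a finite simplicial complex $P$ is an *$\varepsilon$-embedding* if $\operatorname{diam} f^{-1}(p)<\varepsilon$ for all $p\in P$, and $\mathrm{widim}_\varepsilon(A,d)$ is the least integer $n\ge 0$ such that $A$ has an $\varepsilon$-embedding into an $n$-dimensional finite simplicial complex. Given a metric $d$ on $X$ compatible with its topology, put $d_N(x,y)=\max_{0\le n<N}d(T^nx,T^ny)$ and $$\mathrm{mdim}(X,T)=\lim_{\varepsilon\to0}\lim_{N\to\infty}\frac{\mathrm{widim}_\varepsilon(X,d_N)}{N},\qquad \mathrm{mdim}(\pi,T)=\lim_{\varepsilon\to0}\lim_{N\to\infty}\frac{\sup_{y\in Y}\mathrm{widim}_\varepsilon(\pi^{-1}(y),d_N)}{N};$$ these limits exist in $[0,\infty]$ and do not depend on the choice of $d$. **Theorem.** (1) For every $\delta>0$ there is a factor map $\pi:(X,T)\to(Y,S)$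 between dynamical systems with $$\mathrm{mdim}(X,T)=1,\qquad \mathrm{mdim}(Y,S)<\delta,\qquad \mathrm{mdim}(\pi,T)=0.$$ (2) Moreover, let $(Z,R)$ be any nonempty dynamical system that is zero-dimensional ($Z$ is totally disconnected), free (no periodic points) and minimal (every orbit $\{R^nz\mid n\in\mathbb Z\}$ is dense), and let $(X,T)=([0,1]^{\mathbb Z}\times Z,\ \sigma\times R)$, where $\sigma((x_n)_n)=(x_{n+1})_n$ is the shift. Then $\mathrm{mdim}(X,T)=1$, and for every $\delta>0$ there are a dynamical system $(Y,S)$ and a factor map $\pi:(X,T)\to(Y,S)$ with $\mathrm{mdim}(Y,S)<\delta$ and $\mathrm{mdim}(\pi,T)=0$. (3) In particular, the inequality $\mathrm{mdim}(X,T)\le\mathrm{mdim}(Y,S)+\mathrm{mdim}(\pi,T)$ does not hold for all factor maps $\pi:(X,T)\to(Y,S)$. -/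

import Mathlib

open Set Filter Topology TopologicalSpace
open scoped ENNReal

universe u v

/-- A dynamical system: a compact metrizable space with a self-homeomorphism. -/
structure DynSystem where
  carrier : Type u
  [top : TopologicalSpace carrier]
  [compact : CompactSpace carrier]
  [metrizable : MetrizableSpace carrier]
  T : carrier ≃ₜ carrier

namespace DynSystem

instance : CoeSort DynSystem.{u} (Type u) := ⟨DynSystem.carrier⟩

attribute [instance] DynSystem.top DynSystem.compact DynSystem.metrizable

/-- The product of two dynamical systems. -/
def prod (A : DynSystem.{u}) (B : DynSystem.{v}) : DynSystem.{max u v} where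
  carrier := A × B
  T := A.T.prodCongr B.T

/-- No periodic points. -/
def Free (A : DynSystem.{u}) : Prop :=
  ∀ x : A, ∀ n : ℕ, 0 < n → (A.T)^[n] x ≠ x

/-- Every (two-sided) orbit is dense. -/
def Minimal (A : DynSystem.{u}) : Prop :=
  ∀ x : A, Dense (Set.range fun n : ℤ => (A.T ^ n) x)

end DynSystem

/-- The full shift `σ((xₙ)ₙ) = (xₙ₊₁)ₙ` on `[0,1]^ℤ`. -/
def cubeShift : DynSystem.{0} where
  carrier := ℤ → unitInterval
  T :=
    { toFun := fun x n => x (n + 1)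
      invFun := fun x n => x (n - 1)
      left_inv := fun x => by funext n; simp
      right_inv := fun x => by funext n; simp
      continuous_toFun := by fun_prop
      continuous_invFun := by fun_prop }

/-- `π` is a factor map `(X, T) → (Y, S)`: an equivariant continuous surjection. -/
structure IsFactorMap (A : DynSystem.{u}) (B : DynSystem.{v}) (π : A → B) : Prop where
  continuous : Continuous π
  surjective : Function.Surjective π
  equivariant : ∀ x, π (A.T x) = B.T (π x)

/-- `d` is a metric on `X` inducing the given topology. -/
structure IsCompatibleMetric {X : Type u} [TopologicalSpace X] (d : X → X → ℝ) : Prop where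
  self : ∀ x, d x x = 0
  comm : ∀ x y, d x y = d y x
  triangle : ∀ x y z, d x z ≤ d x y + d y z
  eq_of_zero : ∀ x y, d x y = 0 → x = y
  isOpen_iff : ∀ s : Set X, IsOpen s ↔ ∀ x ∈ s, ∃ ε > 0, ∀ y, d x y < ε → y ∈ s

/-- The diameter of `A` with respect to `d`. -/
noncomputable def diamWith {X : Type u} (d : X → X → ℝ) (A : Set X) : ℝ≥0∞ :=
  ⨆ x ∈ A, ⨆ y ∈ A, ENNReal.ofReal (d x y)

/-- The geometric realization of a finite simplicial complex `K` (the vertices are among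
`0, …, k-1`, placed at the unit vectors of `ℝᵏ`), with the topology induced from `ℝᵏ`. -/
def realization {k : ℕ} (K : PreAbstractSimplicialComplex (Fin k)) : Set (Fin k → ℝ) :=
  {x | x ∈ stdSimplex ℝ (Fin k) ∧ ∃ s ∈ K.faces, ∀ i, x i ≠ 0 → i ∈ s}

/-- There is an `ε`-embedding of `(A, d)` into a finite simplicial complex of dimension at most
`n`. -/
def HasEpsEmbedding {X : Type u} [TopologicalSpace X] (d : X → X → ℝ) (ε : ℝ) (A : Set X)
    (n : ℕ) : Prop :=
  ∃ (k : ℕ) (K : PreAbstractSimplicialComplex (Fin k)),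
    (∀ s ∈ K.faces, s.card ≤ n + 1) ∧
    ∃ f : A → realization K, Continuous f ∧
      ∀ p, diamWith d (Subtype.val '' (f ⁻¹' {p})) < ENNReal.ofReal ε

/-- The `ε`-width dimension `widim_ε(A, d)`: the least `n` such that `(A, d)` has an `ε`-embedding
into a finite `n`-dimensional simplicial complex (`⊤` if there is none). -/
noncomputable def widim {X : Type u} [TopologicalSpace X] (d : X → X → ℝ) (ε : ℝ)
    (A : Set X) : ℕ∞ :=
  ⨅ (n : ℕ) (_ : HasEpsEmbedding d ε A n), (n : ℕ∞)

/-- `d_N(x, y) = max_{0 ≤ n < N} d(Tⁿx, Tⁿy)`. -/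
noncomputable def bowenMetric {X : Type u} (d : X → X → ℝ) (T : X → X) (N : ℕ) (x y : X) : ℝ :=
  ⨆ n : Fin N, d (T^[n] x) (T^[n] y)

/-- `lim_{ε → 0} lim_{N → ∞} w ε N / N` exists (both limits do) and equals `a`. -/
def IsMeanLimit (w : ℝ → ℕ → ℕ∞) (a : ℝ≥0∞) : Prop :=
  ∃ l : ℝ → ℝ≥0∞,
    (∀ ε > 0, Tendsto (fun N : ℕ => (w ε N : ℝ≥0∞) / (N : ℝ≥0∞)) atTop (𝓝 (l ε))) ∧
    Tendsto l (𝓝[>] 0) (𝓝 a)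

/-- `mdim(X, T) = a`: for every metric `d` on `X`, the defining double limit of
`widim_ε(X, d_N) / N` exists and equals `a`. -/
def IsMeanDim (A : DynSystem.{u}) (a : ℝ≥0∞) : Prop :=
  ∀ d : A → A → ℝ, IsCompatibleMetric d →
    IsMeanLimit (fun ε N => widim (bowenMetric d A.T N) ε Set.univ) a

/-- `mdim(π, T) = a`: for every metric `d` on `X`, the defining double limit of
`sup_{y ∈ Y} widim_ε(π⁻¹(y), d_N) / N` exists and equals `a`. -/
def IsRelMeanDim (A : DynSystem.{u}) (B : DynSystem.{v}) (π : A → B) (a : ℝ≥0∞) : Prop :=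
  ∀ d : A → A → ℝ, IsCompatibleMetric d →
    IsMeanLimit (fun ε N => ⨆ y : B, widim (bowenMetric d A.T N) ε (π ⁻¹' {y})) a

/-! Width dimension is recast in terms of colours: a compact space has a map with `E`-small fibres
to a complex of dimension at most `a` iff for every `k` there are `k` disjoint families of `E`-small
open sets such that each point is missed by at most `a` of them (`HasCovers`). In this form
intersecting two relations adds the bounds, and clopen conditions cost nothing. Real coordinates are
treated by grids with distinct shifts in `(0, 1)`: a coordinate lies on at most one of the grids,
and a zero coordinate on none, so the width is at most the number of nonzero coordinates
(`HasCovers.of_sparse`).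

The factor of `[0,1]^ℤ × Z` keeps the point of `Z` and, for each level `k`, a coarse code of the
sequence. A marker function cuts every orbit of `Z` into blocks of length at least `n k` and bounded
above; at the start of a block of length `ℓ` the code records `k + 1` reals, the values of
`blockVal`, and elsewhere it is zero. Codes thus have at most about `∑ (k + 1) / n k` nonzero
coordinates per unit of time, which is made smaller than `δ` by long blocks (`mdimWith_code_le`).

The fibres are nevertheless small. About `ℓ` shifted grids are dealt out to the `k + 1` components,
slightly more than `ℓ / (k + 1)` to each, and component `g` is nonzero exactly when some grid dealt
to `g` misses all coordinates of the block. By pigeonhole some component is nonzero, and it has the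
same value along a fibre, so the `ℓ / (k + 1) + 1` grids of that one component cover the fibre: a
block has width at most `ℓ / (k + 1)` at scale `1 / (k + 1)` (`hasCovers_block`). Summing over
blocks gives rate `1 / (k + 1)` for every large `k`, hence relative mean dimension zero
(`isRelMeanDim_codeMap`).

That `[0,1]^ℤ × Z` has mean dimension at least `1` rests on Lebesgue's covering theorem, proved by a
mod 2 cup product argument on the Kuhn triangulation (`exists_unit_cube_nonconstant`,
`le_of_hasCovers_cube`). The dyadic odometer supplies a concrete `Z`. -/

/-! ### A parity lemma on the cubical grid -/

/-- The order embedding `ℕ → ℕ` whose range misses exactly `k`. -/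
def skipIdx (k i : ℕ) : ℕ := if i < k then i else i + 1

lemma skipIdx_zero (i : ℕ) : skipIdx 0 i = i + 1 := by simp [skipIdx]

lemma skipIdx_succ_zero (k : ℕ) : skipIdx (k + 1) 0 = 0 := by simp [skipIdx]

lemma skipIdx_succ_succ (k i : ℕ) : skipIdx (k + 1) (i + 1) = skipIdx k i + 1 := by
  simp only [skipIdx]; split_ifs <;> omega

lemma skipIdx_ne (k i : ℕ) : skipIdx k i ≠ k := by
  simp only [skipIdx]; split_ifs <;> omega

/-- A cup product of coboundaries (with `ZMod 2` coefficients) is a cocycle. -/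
lemma sum_prod_coboundary_eq_zero (n : ℕ) (u : ℕ → ℕ → ZMod 2) :
    ∑ k ∈ Finset.range (n + 2),
      ∏ i ∈ Finset.range n, (u i (skipIdx k i) + u i (skipIdx k (i + 1))) = 0 := by
  induction n generalizing u with
  | zero => simp; decide
  | succ n ih =>
    -- Split off the first factor. The faces `k = 0` and `k = 1` have the same remaining product
    -- `B`, and the other faces contribute `(a + b) * A`. The total is `(a + b) * (A + B)`, and `A +
    -- B = 0` by induction; `decide` checks this over `ZMod 2`.
    have h := ih (fun i p => u (i + 1) (p + 1))
    rw [Finset.sum_range_succ'] at h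
    rw [Finset.sum_range_succ', Finset.sum_range_succ']
    simp only [Finset.prod_range_succ', skipIdx_zero, skipIdx_succ_zero, skipIdx_succ_succ] at h ⊢
    rw [← Finset.sum_mul]
    set A := ∑ k ∈ Finset.range (n + 1), ∏ i ∈ Finset.range n,
      (u (i + 1) (skipIdx (k + 1) i + 1) + u (i + 1) (skipIdx k i + 1 + 1))
    set B := ∏ k ∈ Finset.range n, (u (k + 1) (k + 1 + 1) + u (k + 1) (k + 1 + 1 + 1))
    generalize u 0 0 = a
    generalize u 0 (0 + 1) = b
    generalize u 0 (0 + 1 + 1) = c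
    clear_value A B
    revert a b c A B
    decide

/-- The factor with index `i` of the cochain `du₀ ∪ ⋯ ∪ u_j ∪ ⋯ ∪ du_{N-1}` evaluated on the
simplex with vertices `q 0, q 1, …`. -/
def slotFactor (u : ℕ → ℕ → ZMod 2) (j : ℕ) (q : ℕ → ℕ) (i : ℕ) : ZMod 2 :=
  if i < j then u i (q i) + u i (q (i + 1)) else if i = j then u i (q i)
  else u i (q (i - 1)) + u i (q i)

/-- The coboundary of `du₀ ∪ ⋯ ∪ u_j ∪ ⋯ ∪ du_{n-1}` is `du₀ ∪ ⋯ ∪ du_{n-1}`. -/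
lemma sum_prod_slotFactor (n j : ℕ) (hj : j < n) (u : ℕ → ℕ → ZMod 2) :
    ∑ k ∈ Finset.range (n + 1), ∏ i ∈ Finset.range n, slotFactor u j (skipIdx k) i =
      ∏ i ∈ Finset.range n, (u i i + u i (i + 1)) := by
  induction n generalizing u j with
  | zero => omega
  | succ n ih =>
    rcases j with _ | j
    · have h := sum_prod_coboundary_eq_zero n (fun i => u (i + 1))
      rw [Finset.sum_range_succ'] at h ⊢
      have e : ∀ k i, slotFactor u 0 (skipIdx k) (i + 1) =
          u (i + 1) (skipIdx k i) + u (i + 1) (skipIdx k (i + 1)) := by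
        intro k i; simp [slotFactor]
      have e0 : ∀ k, slotFactor u 0 (skipIdx k) 0 = u 0 (skipIdx k 0) := by
        intro k; simp [slotFactor]
      simp only [Finset.prod_range_succ', e, e0, skipIdx_zero, skipIdx_succ_zero] at h ⊢
      rw [← Finset.sum_mul]
      set A := ∑ k ∈ Finset.range (n + 1), ∏ i ∈ Finset.range n,
        (u (i + 1) (skipIdx (k + 1) i) + u (i + 1) (skipIdx (k + 1) (i + 1)))
      set B := ∏ k ∈ Finset.range n, (u (k + 1) (k + 1) + u (k + 1) (k + 1 + 1))
      generalize u 0 0 = a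
      generalize u 0 (0 + 1) = b
      clear_value A B
      revert a b A B
      decide
    · have h := ih j (by omega) (fun i p => u (i + 1) (p + 1))
      have e : ∀ k i, slotFactor u (j + 1) (skipIdx (k + 1)) (i + 1) =
          slotFactor (fun i p => u (i + 1) (p + 1)) j (skipIdx k) i := by
        intro k i
        simp only [slotFactor, skipIdx_succ_succ, add_lt_add_iff_right, add_left_inj]
        split_ifs with h1 h2
        · rfl
        · rfl
        · obtain ⟨i, rfl⟩ : ∃ i', i = i' + 1 := ⟨i - 1, by omega⟩
          simp [skipIdx_succ_succ]
      have e' : ∀ i, slotFactor u (j + 1) (skipIdx 0) (i + 1) =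
          slotFactor (fun i p => u (i + 1) (p + 1)) j (skipIdx 0) i := by
        intro i
        simp only [slotFactor, skipIdx_zero, add_lt_add_iff_right, add_left_inj]
        split_ifs with h1 h2
        · rfl
        · rfl
        · obtain ⟨i, rfl⟩ : ∃ i', i = i' + 1 := ⟨i - 1, by omega⟩
          simp
      have e0 : ∀ k, slotFactor u (j + 1) (skipIdx k) 0 =
          u 0 (skipIdx k 0) + u 0 (skipIdx k 1) := by
        intro k; simp [slotFactor]
      rw [Finset.sum_range_succ', Finset.sum_range_succ']
      rw [Finset.sum_range_succ'] at h
      have e1 : ∀ k, skipIdx (k + 1 + 1) 1 = 1 := by intro k; simp [skipIdx]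
      have e2 : skipIdx (0 + 1) 1 = 2 := by simp [skipIdx]
      have e3 : skipIdx 0 1 = 2 := by simp [skipIdx]
      have e4 : skipIdx 0 0 = 1 := by simp [skipIdx]
      simp only [Finset.prod_range_succ' _ n, e, e', e0, e1, e2, e3, e4, skipIdx_succ_zero]
      rw [← Finset.sum_mul, ← h]
      set A := ∑ k ∈ Finset.range n, ∏ i ∈ Finset.range n,
        slotFactor (fun i p => u (i + 1) (p + 1)) j (skipIdx (k + 1)) i
      set B := ∏ i ∈ Finset.range n, slotFactor (fun i p => u (i + 1) (p + 1)) j (skipIdx 0) i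
      generalize u 0 0 = a
      generalize u 0 (0 + 1) = b
      generalize u 0 2 = c
      generalize u 0 1 = b'
      clear h
      clear_value A B
      revert a b b' c A B
      decide

/-- The slot factor uses a single vertex instead of an edge, so only the `n` vertices `q 0, …, q (n
- 1)` of a facet enter. -/
lemma prod_slotFactor_congr {n j : ℕ} (hj : j < n) {u u' : ℕ → ℕ → ZMod 2} {q q' : ℕ → ℕ}
    (h : ∀ i, ∀ l < n, u i (q l) = u' i (q' l)) :
    ∏ i ∈ Finset.range n, slotFactor u j q i = ∏ i ∈ Finset.range n, slotFactor u' j q' i := by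
  refine Finset.prod_congr rfl fun i hi => ?_
  rw [Finset.mem_range] at hi
  simp only [slotFactor]
  split_ifs with h1 h2
  · rw [h i i hi, h i (i + 1) (by omega)]
  · rw [h i i hi]
  · rw [h i i hi, h i (i - 1) (by omega)]

/-! ### The Kuhn triangulation and a mod 2 Stokes formula -/

/-- The vertices of the simplex of the Kuhn triangulation of `ℝⁿ` with smallest vertex `x`, where
the coordinate `i` is increased at time `ρ i`. -/
def kuhnVertex {n : ℕ} (x : Fin n → ℕ) (ρ : Equiv.Perm (Fin n)) (k : ℕ) : Fin n → ℕ :=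
  fun i => x i + if (ρ i : ℕ) < k then 1 else 0

/-- The simplices of the Kuhn triangulation of the cube `[0, m]ⁿ`. -/
def kuhnSimplices (n m : ℕ) : Finset ((Fin n → ℕ) × Equiv.Perm (Fin n)) :=
  (Fintype.piFinset fun _ => Finset.range m) ×ˢ Finset.univ

lemma mem_kuhnSimplices {n m : ℕ} {s : (Fin n → ℕ) × Equiv.Perm (Fin n)} :
    s ∈ kuhnSimplices n m ↔ ∀ i, s.1 i < m := by
  simp [kuhnSimplices]

/-- The value of `dH₀ ∪ ⋯ ∪ H_j ∪ ⋯ ∪ dH_{n-1}` on the facet opposite to the vertex `k`. -/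
def facetValue {n : ℕ} (H : ℕ → (Fin n → ℕ) → ZMod 2) (j k : ℕ)
    (s : (Fin n → ℕ) × Equiv.Perm (Fin n)) : ZMod 2 :=
  ∏ i ∈ Finset.range n, slotFactor (fun i l => H i (kuhnVertex s.1 s.2 l)) j (skipIdx k) i

lemma facetValue_congr {n : ℕ} {H : ℕ → (Fin n → ℕ) → ZMod 2} {j k k' : ℕ} (hj : j < n)
    {s s' : (Fin n → ℕ) × Equiv.Perm (Fin n)}
    (h : ∀ l < n, kuhnVertex s.1 s.2 (skipIdx k l) = kuhnVertex s'.1 s'.2 (skipIdx k' l)) :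
    facetValue H j k s = facetValue H j k' s' :=
  prod_slotFactor_congr hj fun i l hl => by simp only [h l hl]

/-- The facet opposite an interior vertex `k` is shared by exactly two simplices with the same base
point: exchanging the directions increased at times `k - 1` and `k` changes only vertex `k`. The
contributions cancel in pairs. -/
lemma sum_facetValue_interior {n m : ℕ} (H : ℕ → (Fin n → ℕ) → ZMod 2) {j k : ℕ} (hj : j < n)
    (hk0 : 0 < k) (hkn : k < n) : ∑ s ∈ kuhnSimplices n m, facetValue H j k s = 0 := by
  let a : Fin n := ⟨k - 1, by omega⟩
  let b : Fin n := ⟨k, hkn⟩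
  have hab : a ≠ b := by simp [a, b, Fin.ext_iff]; omega
  refine Finset.sum_involution (fun s _ => (s.1, Equiv.swap a b * s.2)) ?_ ?_ ?_ ?_
  · rintro ⟨x, ρ⟩ -
    rw [facetValue_congr (s' := (x, Equiv.swap a b * ρ)) (k' := k) hj]
    · exact CharTwo.add_self_eq_zero _
    intro l hl
    funext i
    have hne := skipIdx_ne k l
    generalize skipIdx k l = q at hne
    simp only [kuhnVertex, Equiv.Perm.coe_mul, Function.comp_apply]
    congr 2
    rw [Equiv.swap_apply_def]
    split_ifs with h1 h2
    · rw [h1]; simp only [a, b, eq_iff_iff]; omega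
    · rw [h2]; simp only [a, b, eq_iff_iff]; omega
    · rfl
  · rintro ⟨x, ρ⟩ - - h
    have h2 : Equiv.swap a b * ρ = ρ := congrArg Prod.snd h
    rw [mul_eq_right, Equiv.swap_eq_one_iff] at h2
    exact hab h2
  · rintro ⟨x, ρ⟩ h
    rw [mem_kuhnSimplices] at h ⊢
    exact h
  · rintro ⟨x, ρ⟩ -
    simp [← mul_assoc]

/-- The boundary conditions for a family of functions on the grid `{0, …, m}ⁿ`: for `i ≠ j` the
function `H i` is constant on each of the two faces orthogonal to the direction `i`, and
`H j` vanishes on both faces orthogonal to the direction `j`. -/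
structure FaceConditions {n : ℕ} (m : ℕ) (H : ℕ → (Fin n → ℕ) → ZMod 2) (j : ℕ) : Prop where
  lower : ∀ i : Fin n, (i : ℕ) ≠ j → ∀ p, p i = 0 → H i p = 0
  upper : ∀ i : Fin n, (i : ℕ) ≠ j → ∀ p, p i = m → H i p = 1
  slot_lower : ∀ i : Fin n, (i : ℕ) = j → ∀ p, p i = 0 → H i p = 0
  slot_upper : ∀ i : Fin n, (i : ℕ) = j → ∀ p, p i = m → H i p = 0

/-- On a facet inside a face of the cube orthogonal to direction `i`, the factor with index `i`
vanishes: for `i ≠ j` it adds two equal values, and for `i = j` the slot function is zero there. -/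
lemma FaceConditions.facetValue_eq_zero {n m : ℕ} {H : ℕ → (Fin n → ℕ) → ZMod 2} {j k : ℕ}
    (hH : FaceConditions m H j) (hj : j < n) {s : (Fin n → ℕ) × Equiv.Perm (Fin n)} (i : Fin n)
    (h : (∀ l < n, kuhnVertex s.1 s.2 (skipIdx k l) i = 0) ∨
      ∀ l < n, kuhnVertex s.1 s.2 (skipIdx k l) i = m) :
    facetValue H j k s = 0 := by
  refine Finset.prod_eq_zero (Finset.mem_range.2 i.2) ?_
  simp only [slotFactor]
  rcases h with h | h
  · split_ifs with h1 h2
    · rw [hH.lower i h1.ne _ (h i i.2), hH.lower i h1.ne _ (h (i + 1) (by omega))]; rfl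
    · exact hH.slot_lower i h2 _ (h i i.2)
    · rw [hH.lower i h2 _ (h i i.2), hH.lower i h2 _ (h (i - 1) (by omega))]; rfl
  · split_ifs with h1 h2
    · rw [hH.upper i h1.ne _ (h i i.2), hH.upper i h1.ne _ (h (i + 1) (by omega))]; rfl
    · exact hH.slot_upper i h2 _ (h i i.2)
    · rw [hH.upper i h2 _ (h i i.2), hH.upper i h2 _ (h (i - 1) (by omega))]; rfl

/-- Crossing the facet opposite the last vertex leads to the simplex whose base point is moved back
by one in the direction increased last, that direction now being increased first; there the facet is
opposite the first vertex. Facets with no neighbour lie on the boundary and contribute zero. -/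
lemma FaceConditions.sum_facetValue_first_eq_last {n m : ℕ}
    {H : ℕ → (Fin (n + 1) → ℕ) → ZMod 2} {j : ℕ}
    (hH : FaceConditions m H j) (hj : j < n + 1) :
    ∑ s ∈ kuhnSimplices (n + 1) m, facetValue H j (n + 1) s =
      ∑ s ∈ kuhnSimplices (n + 1) m, facetValue H j 0 s := by
  have hskip : ∀ l < n + 1, skipIdx (n + 1) l = l := fun l hl => by simp [skipIdx, hl]
  have hpos : ∀ s : (Fin (n + 1) → ℕ) × Equiv.Perm (Fin (n + 1)),
      facetValue H j (n + 1) s ≠ 0 → ∀ i, s.2 i = Fin.last n → 0 < s.1 i := by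
    intro s hs i hi
    by_contra h0
    refine hs (hH.facetValue_eq_zero hj i (Or.inl fun l hl => ?_))
    rw [hskip l hl]
    simp only [kuhnVertex, hi, Fin.val_last]
    rw [if_neg (by omega)]
    omega
  have hval : ∀ s : (Fin (n + 1) → ℕ) × Equiv.Perm (Fin (n + 1)),
      (∀ i, s.2 i = Fin.last n → 0 < s.1 i) → facetValue H j (n + 1) s =
      facetValue H j 0 (fun i => if s.2 i = Fin.last n then s.1 i - 1 else s.1 i,
        finRotate (n + 1) * s.2) := by
    intro s hs
    refine facetValue_congr hj fun l hl => funext fun i => ?_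
    rw [hskip l hl, skipIdx_zero]
    simp only [kuhnVertex, Equiv.Perm.coe_mul, Function.comp_apply, coe_finRotate]
    by_cases hi : s.2 i = Fin.last n
    · have := hs i hi
      rw [if_neg (by rw [hi, Fin.val_last]; omega)]
      simp only [hi, if_true]
      rw [if_pos (by omega)]
      omega
    · simp only [hi, if_false, add_lt_add_iff_right]
  refine Finset.sum_bij_ne_zero
    (fun s _ _ => (fun i => if s.2 i = Fin.last n then s.1 i - 1 else s.1 i,
        finRotate (n + 1) * s.2)) ?_ ?_ ?_ ?_
  · intro s hs h0
    rw [mem_kuhnSimplices] at hs ⊢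
    intro i
    have := hs i
    dsimp only
    split_ifs <;> omega
  · rintro ⟨x, ρ⟩ h1 h2 ⟨x', ρ'⟩ h1' h2' he
    rw [Prod.mk.injEq, mul_right_inj] at he
    obtain ⟨he, rfl⟩ := he
    dsimp only at he
    refine Prod.ext (funext fun i => ?_) rfl
    have e := congrFun he i
    have p1 := hpos _ h2 i
    have p2 := hpos _ h2' i
    dsimp only at e p1 p2 ⊢
    split_ifs at e with hl
    · have := p1 hl; have := p2 hl; omega
    · exact e
  · rintro ⟨x, ρ⟩ h1 h2
    rw [mem_kuhnSimplices] at h1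
    have hlt : ∀ i, ρ i = 0 → x i + 1 < m := by
      intro i hi
      by_contra h0
      refine h2 (hH.facetValue_eq_zero hj i (Or.inr fun l hl => ?_))
      rw [skipIdx_zero]
      have := h1 i
      simp only [kuhnVertex, hi]
      simp
      dsimp only at this
      omega
    have hlast : ∀ i, (finRotate (n + 1)).symm (ρ i) = Fin.last n ↔ ρ i = 0 := by
      intro i
      rw [Equiv.symm_apply_eq, finRotate_last]
    let s : (Fin (n + 1) → ℕ) × Equiv.Perm (Fin (n + 1)) :=
      (fun i => if ρ i = 0 then x i + 1 else x i, (finRotate (n + 1))⁻¹ * ρ)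
    have hs2 : ∀ i, s.2 i = Fin.last n ↔ ρ i = 0 := hlast
    have himg : ((fun i => if s.2 i = Fin.last n then s.1 i - 1 else s.1 i,
        finRotate (n + 1) * s.2) : (Fin (n + 1) → ℕ) × Equiv.Perm (Fin (n + 1))) = (x, ρ) := by
      refine Prod.ext (funext fun i => ?_) (by simp [s])
      simp only [hs2]
      by_cases hi : ρ i = 0 <;> simp [s, hi]
    refine ⟨s, ?_, ?_, himg⟩
    · rw [mem_kuhnSimplices]
      intro i
      have := h1 i
      by_cases hi : ρ i = 0
      · simpa [s, hi] using hlt i hi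
      · simpa [s, hi] using this
    · rw [hval s, himg]
      · exact h2
      · intro i hi
        rw [hs2] at hi
        simp [s, hi]
  · intro s hs h0
    exact hval s (hpos s h0)

/-- The value of `dH₀ ∪ ⋯ ∪ dH_{n-1}` on a simplex of the Kuhn triangulation. -/
def simplexValue {n : ℕ} (H : ℕ → (Fin n → ℕ) → ZMod 2)
    (s : (Fin n → ℕ) × Equiv.Perm (Fin n)) : ZMod 2 :=
  ∏ i ∈ Finset.range n, (H i (kuhnVertex s.1 s.2 i) + H i (kuhnVertex s.1 s.2 (i + 1)))

/-- Stokes: the integrand is the coboundary of the cochain with slot `j`, interior facets cancel in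
pairs, and boundary facets contribute zero. -/
lemma FaceConditions.sum_simplexValue_eq_zero {n m : ℕ}
    {H : ℕ → (Fin n → ℕ) → ZMod 2} {j : ℕ}
    (hH : FaceConditions m H j) (hj : j < n) :
    ∑ s ∈ kuhnSimplices n m, simplexValue H s = 0 := by
  obtain ⟨n, rfl⟩ : ∃ n', n = n' + 1 := ⟨n - 1, by omega⟩
  have h : ∀ s : (Fin (n + 1) → ℕ) × Equiv.Perm (Fin (n + 1)),
      simplexValue H s = ∑ k ∈ Finset.range (n + 1 + 1), facetValue H j k s := fun s =>
    (sum_prod_slotFactor (n + 1) j hj fun i l => H i (kuhnVertex s.1 s.2 l)).symm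
  simp only [h]
  rw [Finset.sum_comm, Finset.sum_range_succ, Finset.sum_range_succ',
    hH.sum_facetValue_first_eq_last hj, Finset.sum_eq_zero, zero_add]
  · exact CharTwo.add_self_eq_zero _
  · intro k hk
    rw [Finset.mem_range] at hk
    exact sum_facetValue_interior H hj (by omega) (by omega)

/-- The integrand is additive in the function with index `j`, and `H j + H' j` vanishes on both
faces orthogonal to `j`. The difference of the two sums is therefore covered by the Stokes formula.
-/
lemma sum_simplexValue_congr {n m : ℕ} {H H' : ℕ → (Fin n → ℕ) → ZMod 2} {j : ℕ} (hj : j < n)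
    (hne : ∀ i, i ≠ j → H i = H' i)
    (h0 : ∀ i : Fin n, ∀ p, p i = 0 → H i p = 0) (h1 : ∀ i : Fin n, ∀ p, p i = m → H i p = 1)
    (h0' : ∀ i : Fin n, ∀ p, p i = 0 → H' i p = 0)
    (h1' : ∀ i : Fin n, ∀ p, p i = m → H' i p = 1) :
    ∑ s ∈ kuhnSimplices n m, simplexValue H s = ∑ s ∈ kuhnSimplices n m, simplexValue H' s := by
  let G : ℕ → (Fin n → ℕ) → ZMod 2 := fun i p => if i = j then H j p + H' j p else H i p
  have hG : FaceConditions m G j := by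
    refine ⟨fun i hi p hp => ?_, fun i hi p hp => ?_, fun i hi p hp => ?_, fun i hi p hp => ?_⟩
    · simp only [G, if_neg hi]; exact h0 i p hp
    · simp only [G, if_neg hi]; exact h1 i p hp
    · simp only [G, ← hi]; rw [h0 i p hp, h0' i p hp]; rfl
    · simp only [G, ← hi]; rw [h1 i p hp, h1' i p hp]; rfl
  have key : ∀ s, simplexValue H s + simplexValue H' s = simplexValue G s := by
    intro s
    have hmem : j ∈ Finset.range n := Finset.mem_range.2 hj
    simp only [simplexValue]
    rw [← Finset.mul_prod_erase _ _ hmem, ← Finset.mul_prod_erase _ _ hmem,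
      ← Finset.mul_prod_erase _ _ hmem]
    have e1 : ∏ i ∈ (Finset.range n).erase j,
        (H' i (kuhnVertex s.1 s.2 i) + H' i (kuhnVertex s.1 s.2 (i + 1))) =
        ∏ i ∈ (Finset.range n).erase j,
        (H i (kuhnVertex s.1 s.2 i) + H i (kuhnVertex s.1 s.2 (i + 1))) :=
      Finset.prod_congr rfl fun i hi => by rw [hne i (Finset.ne_of_mem_erase hi)]
    have e2 : ∏ i ∈ (Finset.range n).erase j,
        (G i (kuhnVertex s.1 s.2 i) + G i (kuhnVertex s.1 s.2 (i + 1))) =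
        ∏ i ∈ (Finset.range n).erase j,
        (H i (kuhnVertex s.1 s.2 i) + H i (kuhnVertex s.1 s.2 (i + 1))) :=
      Finset.prod_congr rfl fun i hi => by simp only [G, if_neg (Finset.ne_of_mem_erase hi)]
    rw [e1, e2]
    simp only [G, if_true]
    ring
  have := hG.sum_simplexValue_eq_zero hj
  simp only [← key, Finset.sum_add_distrib] at this
  rwa [CharTwo.add_eq_zero] at this

/-- For the indicators of `p i ≠ 0`, factor `i` is nonzero only if direction `i` leaves `0` exactly
at time `i`. Only the simplex at the origin with the identity order survives. -/
lemma sum_simplexValue_coord {n m : ℕ} (hm : 0 < m) (H : ℕ → (Fin n → ℕ) → ZMod 2)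
    (hH : ∀ i : Fin n, ∀ p, H i p = if p i = 0 then 0 else 1) :
    ∑ s ∈ kuhnSimplices n m, simplexValue H s = 1 := by
  have hfac : ∀ (s : (Fin n → ℕ) × Equiv.Perm (Fin n)) (i : Fin n),
      H i (kuhnVertex s.1 s.2 i) + H i (kuhnVertex s.1 s.2 (i + 1)) =
        if s.1 i = 0 ∧ s.2 i = i then 1 else 0 := by
    intro s i
    have e : s.2 i = i ↔ (s.2 i : ℕ) = i := Fin.ext_iff
    have ha : ∀ k, kuhnVertex s.1 s.2 k i = s.1 i + if (s.2 i : ℕ) < k then 1 else 0 :=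
      fun _ => rfl
    have h1 := ha i
    have h2 := ha (i + 1)
    simp only [hH, e]
    generalize kuhnVertex s.1 s.2 i i = a at *
    generalize kuhnVertex s.1 s.2 (i + 1) i = b at *
    by_cases hx : s.1 i = 0 ∧ (s.2 i : ℕ) = i
    · rw [if_neg (by omega)] at h1
      rw [if_pos (by omega)] at h2
      rw [if_pos (by omega), if_neg (by omega), if_pos hx, zero_add]
    · rw [if_neg hx]
      have : a = 0 ↔ b = 0 := by split_ifs at h1 h2 <;> omega
      by_cases hb : b = 0
      · rw [if_pos hb, if_pos (this.2 hb), zero_add]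
      · rw [if_neg hb, if_neg (mt this.1 hb)]
        exact CharTwo.add_self_eq_zero _
  have hprod : ∀ s : (Fin n → ℕ) × Equiv.Perm (Fin n), simplexValue H s =
      ∏ i : Fin n, if s.1 i = 0 ∧ s.2 i = i then 1 else 0 := by
    intro s
    rw [simplexValue, Finset.prod_range]
    exact Finset.prod_congr rfl fun i _ => hfac s i
  rw [Finset.sum_eq_single ((0, 1) : (Fin n → ℕ) × Equiv.Perm (Fin n))]
  · rw [hprod]; simp
  · intro s _ hs
    rw [hprod]
    by_contra h
    apply hs
    rw [← ne_eq, Finset.prod_ne_zero_iff] at h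
    have h' : ∀ i, s.1 i = 0 ∧ s.2 i = i := by
      intro i
      by_contra hi
      exact h i (Finset.mem_univ i) (if_neg hi)
    exact Prod.ext (funext fun i => (h' i).1) (Equiv.ext fun i => (h' i).2)
  · intro h
    exact absurd (mem_kuhnSimplices.2 fun i => hm) h

/-- If `F i` is `0` on the face `p i = 0` and `1` on the face `p i = m` of the grid, then
there is a unit cube on which no `F i` is constant. -/
theorem exists_unit_cube_nonconstant {n m : ℕ} (hm : 0 < m) (F : Fin n → (Fin n → ℕ) → ZMod 2)
    (h0 : ∀ i p, p i = 0 → F i p = 0) (h1 : ∀ i p, p i = m → F i p = 1) :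
    ∃ x : Fin n → ℕ, (∀ i, x i < m) ∧ ∀ i, ∃ p q : Fin n → ℕ,
      (∀ l, x l ≤ p l ∧ p l ≤ x l + 1) ∧ (∀ l, x l ≤ q l ∧ q l ≤ x l + 1) ∧ F i p ≠ F i q := by
  classical
  let F' : ℕ → (Fin n → ℕ) → ZMod 2 := fun i p => if h : i < n then F ⟨i, h⟩ p else 0
  let c : ℕ → (Fin n → ℕ) → ZMod 2 := fun i p => if h : i < n then
    (if p ⟨i, h⟩ = 0 then 0 else 1) else 0
  -- Replace the functions by the model functions `c` one index at a time; no replacement changes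
  -- the sum, which is therefore `1`.
  let H : ℕ → ℕ → (Fin n → ℕ) → ZMod 2 := fun j i => if i < j then c i else F' i
  have hF' : ∀ (i : Fin n) p, F' i p = F i p := fun i p => by simp [F']
  have hc : ∀ (i : Fin n) p, c i p = if p i = 0 then 0 else 1 := fun i p => by simp [c]
  have H0 : ∀ j (i : Fin n) p, p i = 0 → H j i p = 0 := by
    intro j i p hp
    simp only [H]
    split_ifs
    · rw [hc, if_pos hp]
    · rw [hF', h0 i p hp]
  have H1 : ∀ j (i : Fin n) p, p i = m → H j i p = 1 := by
    intro j i p hp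
    simp only [H]
    split_ifs
    · rw [hc, if_neg (by omega)]
    · rw [hF', h1 i p hp]
  have step : ∀ j ≤ n, ∑ s ∈ kuhnSimplices n m, simplexValue (H 0) s =
      ∑ s ∈ kuhnSimplices n m, simplexValue (H j) s := by
    intro j
    induction j with
    | zero => intro _; rfl
    | succ j ih =>
      intro hj
      rw [ih (by omega)]
      refine sum_simplexValue_congr (j := j) (by omega) ?_ (H0 _) (H1 _) (H0 _) (H1 _)
      intro i hi
      simp only [H]
      split_ifs <;> first | rfl | omega
  have hone : ∑ s ∈ kuhnSimplices n m, simplexValue (H 0) s = 1 := by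
    rw [step n le_rfl]
    refine sum_simplexValue_coord hm _ fun i p => ?_
    simp only [H, if_pos i.2, hc]
  obtain ⟨s, hs, hne⟩ := Finset.exists_ne_zero_of_sum_ne_zero (hone.trans_ne one_ne_zero)
  refine ⟨s.1, mem_kuhnSimplices.1 hs, fun i => ⟨kuhnVertex s.1 s.2 i,
    kuhnVertex s.1 s.2 (i + 1), fun l => ?_, fun l => ?_, fun heq => ?_⟩⟩
  · simp only [kuhnVertex]; split_ifs <;> omega
  · simp only [kuhnVertex]; split_ifs <;> omega
  · rw [simplexValue, Finset.prod_ne_zero_iff] at hne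
    apply hne i (Finset.mem_range.2 i.2)
    simp only [H, Nat.not_lt_zero, if_false, hF', heq]
    exact CharTwo.add_self_eq_zero _

/-! ### Coloured covers -/

/-- A partial equivalence relation contained in `E` whose classes are open. Its classes form a
disjoint family of `E`-small open sets. -/
structure IsOpenPER {α : Type*} [TopologicalSpace α] (E r : α → α → Prop) : Prop where
  symm : ∀ x y, r x y → r y x
  trans : ∀ x y z, r x y → r y z → r x z
  isOpen : ∀ x, IsOpen {y | r x y}
  sub : ∀ x y, r x y → E x y

/-- The space is covered by `a + 1` disjoint families of `E`-small open sets. -/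
def HasCover {α : Type*} [TopologicalSpace α] (E : α → α → Prop) (a : ℕ) : Prop :=
  ∃ r : Fin (a + 1) → α → α → Prop, (∀ i, IsOpenPER E (r i)) ∧ ∀ x, ∃ i, r i x x

/-- For every `k` there are `k` disjoint families of `E`-small open sets such that each point is
missed by at most `a` of the families. -/
def HasCovers {α : Type*} [TopologicalSpace α] (E : α → α → Prop) (a : ℕ) : Prop :=
  ∀ k : ℕ, ∃ r : Fin k → α → α → Prop, (∀ i, IsOpenPER E (r i)) ∧
    ∀ x, ∃ s : Finset (Fin k), s.card ≤ a ∧ ∀ i, i ∉ s → r i x x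

/-- There is a continuous map to a finite simplicial complex of dimension at most `a` all of whose
fibres are `E`-small. -/
def HasComplexMap {α : Type*} [TopologicalSpace α] (E : α → α → Prop) (a : ℕ) : Prop :=
  ∃ (n : ℕ) (K : PreAbstractSimplicialComplex (Fin n)), (∀ s ∈ K.faces, s.card ≤ a + 1) ∧
    ∃ F : α → realization K, Continuous F ∧ ∀ x y, F x = F y → E x y

section Covers

variable {α β ι : Type*} [TopologicalSpace α] [TopologicalSpace β]

lemma IsOpenPER.mono {E E' r : α → α → Prop} (h : IsOpenPER E r) (hE : ∀ x y, E x y → E' x y) :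
    IsOpenPER E' r :=
  ⟨h.symm, h.trans, h.isOpen, fun x y hr => hE x y (h.sub x y hr)⟩

lemma IsOpenPER.comap {E r : β → β → Prop} (h : IsOpenPER E r) {f : α → β} (hf : Continuous f) :
    IsOpenPER (fun x y => E (f x) (f y)) (fun x y => r (f x) (f y)) :=
  ⟨fun _ _ => h.symm _ _, fun _ _ _ => h.trans _ _ _, fun x => (h.isOpen (f x)).preimage hf,
    fun _ _ => h.sub _ _⟩

lemma IsOpenPER.inf {E E' r r' : α → α → Prop} (h : IsOpenPER E r) (h' : IsOpenPER E' r') :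
    IsOpenPER (fun x y => E x y ∧ E' x y) (fun x y => r x y ∧ r' x y) :=
  ⟨fun _ _ hr => ⟨h.symm _ _ hr.1, h'.symm _ _ hr.2⟩,
    fun _ _ _ hr hs => ⟨h.trans _ _ _ hr.1 hs.1, h'.trans _ _ _ hr.2 hs.2⟩,
    fun x => (h.isOpen x).inter (h'.isOpen x),
    fun _ _ hr => ⟨h.sub _ _ hr.1, h'.sub _ _ hr.2⟩⟩

lemma HasCovers.mono {E E' : α → α → Prop} {a : ℕ} (h : HasCovers E a)
    (hE : ∀ x y, E x y → E' x y) : HasCovers E' a := fun k => by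
  obtain ⟨r, hr, hx⟩ := h k
  exact ⟨r, fun i => (hr i).mono hE, hx⟩

lemma HasCovers.mono_right {E : α → α → Prop} {a a' : ℕ} (h : HasCovers E a) (ha : a ≤ a') :
    HasCovers E a' := fun k => by
  obtain ⟨r, hr, hx⟩ := h k
  refine ⟨r, hr, fun x => ?_⟩
  obtain ⟨s, hs, hs'⟩ := hx x
  exact ⟨s, hs.trans ha, hs'⟩

lemma HasCovers.comap {E : β → β → Prop} {a : ℕ} (h : HasCovers E a) {f : α → β}
    (hf : Continuous f) : HasCovers (fun x y => E (f x) (f y)) a := fun k => by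
  obtain ⟨r, hr, hx⟩ := h k
  exact ⟨fun i x y => r i (f x) (f y), fun i => (hr i).comap hf, fun x => hx (f x)⟩

/-- Additivity is the reason for allowing any number `k` of colours: families of equal colour are
intersected, and the sets of missed colours are united. -/
lemma HasCovers.inf {E E' : α → α → Prop} {a a' : ℕ} (h : HasCovers E a) (h' : HasCovers E' a') :
    HasCovers (fun x y => E x y ∧ E' x y) (a + a') := fun k => by
  classical
  obtain ⟨r, hr, hx⟩ := h k
  obtain ⟨r', hr', hx'⟩ := h' k
  refine ⟨fun i x y => r i x y ∧ r' i x y, fun i => (hr i).inf (hr' i), fun x => ?_⟩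
  obtain ⟨s, hs, hs'⟩ := hx x
  obtain ⟨t, ht, ht'⟩ := hx' x
  refine ⟨s ∪ t, (Finset.card_union_le _ _).trans (add_le_add hs ht), fun i hi => ?_⟩
  rw [Finset.notMem_union] at hi
  exact ⟨hs' i hi.1, ht' i hi.2⟩

lemma HasCovers.of_clopen {c : α → Prop} (hc : IsClopen {x | c x}) :
    HasCovers (fun x y => (c x ↔ c y)) 0 := fun k =>
  ⟨fun _ x y => (c x ↔ c y), fun _ => ⟨fun _ _ => Iff.symm, fun _ _ _ => Iff.trans, fun x => by
    by_cases hx : c x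
    · simpa [hx] using hc.isOpen
    · simp only [hx, false_iff]; exact hc.compl.isOpen, fun _ _ => id⟩,
    fun x => ⟨∅, by simp, fun _ _ => Iff.rfl⟩⟩

lemma HasCovers.top : HasCovers (fun _ _ : α => True) 0 := fun _ =>
  ⟨fun _ _ _ => True, fun _ => ⟨fun _ _ => id, fun _ _ _ _ => id, fun _ => by simp, fun _ _ => id⟩,
    fun _ => ⟨∅, by simp, fun _ _ => trivial⟩⟩

lemma HasCovers.finset_inf {E : ι → α → α → Prop} {a : ι → ℕ} (s : Finset ι)
    (h : ∀ i ∈ s, HasCovers (E i) (a i)) :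
    HasCovers (fun x y => ∀ i ∈ s, E i x y) (∑ i ∈ s, a i) := by
  classical
  induction s using Finset.induction_on with
  | empty => simpa using HasCovers.top
  | insert i s hi ih =>
    rw [Finset.sum_insert hi]
    refine ((h i (Finset.mem_insert_self i s)).inf
      (ih fun j hj => h j (Finset.mem_insert_of_mem hj))).mono fun x y hxy => ?_
    rw [Finset.forall_mem_insert]
    exact hxy

lemma HasCovers.hasCover {E : α → α → Prop} {a : ℕ} (h : HasCovers E a) : HasCover E a := by
  obtain ⟨r, hr, hx⟩ := h (a + 1)
  refine ⟨r, hr, fun x => ?_⟩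
  obtain ⟨s, hs, hs'⟩ := hx x
  obtain ⟨i, hi⟩ : ∃ i, i ∉ s := by
    by_contra! hall
    have : s = Finset.univ := Finset.eq_univ_of_forall hall
    rw [this, Finset.card_univ, Fintype.card_fin] at hs
    omega
  exact ⟨i, hs' i hi⟩

end Covers

/-! ### Shifted grids on the line -/

/-- The reals `t` and `t'` lie in the same open interval of the grid of mesh `1 / Q` shifted
by `s / Q`. -/
def GridRel (Q s t t' : ℝ) : Prop :=
  ∃ v : ℤ, (v < Q * t - s ∧ Q * t - s < v + 1) ∧ v < Q * t' - s ∧ Q * t' - s < v + 1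

lemma GridRel.symm {Q s t t' : ℝ} : GridRel Q s t t' → GridRel Q s t' t :=
  fun ⟨v, h, h'⟩ => ⟨v, h', h⟩

lemma GridRel.trans {Q s t t' t'' : ℝ} :
    GridRel Q s t t' → GridRel Q s t' t'' → GridRel Q s t t'' := by
  rintro ⟨v, h, h'⟩ ⟨w, g, g'⟩
  have : v = w := by
    have h1 : (v : ℝ) < w + 1 := h'.1.trans g.2
    have h2 : (w : ℝ) < v + 1 := g.1.trans h'.2
    norm_cast at h1 h2
    omega
  subst this
  exact ⟨v, h, g'⟩

lemma GridRel.abs_sub_lt {Q s t t' : ℝ} (hQ : 0 < Q) : GridRel Q s t t' → |t - t'| < 1 / Q := by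
  rintro ⟨v, h, h'⟩
  rw [abs_lt, lt_div_iff₀ hQ, neg_lt, ← neg_sub, neg_neg, lt_div_iff₀ hQ]
  constructor <;> nlinarith [h.1, h.2, h'.1, h'.2]

lemma GridRel.isOpen (Q s t : ℝ) : IsOpen {t' | GridRel Q s t t'} := by
  have : {t' | GridRel Q s t t'} = ⋃ v : ℤ, {t' | (v < Q * t - s ∧ Q * t - s < v + 1) ∧
      v < Q * t' - s ∧ Q * t' - s < v + 1} := by
    ext; simp [GridRel]
  rw [this]
  have hc : Continuous fun t' : ℝ => Q * t' - s := by fun_prop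
  exact isOpen_iUnion fun v => isOpen_const.and
    ((isOpen_lt continuous_const hc).and (isOpen_lt hc continuous_const))

lemma GridRel.self_iff {Q s t : ℝ} : GridRel Q s t t ↔ ∀ v : ℤ, Q * t - s ≠ v := by
  constructor
  · rintro ⟨v, ⟨h1, h2⟩, -⟩ w hw
    rw [hw] at h1 h2
    norm_cast at h1 h2
    omega
  · intro h
    have h1 := lt_of_le_of_ne (Int.floor_le (Q * t - s)) (h _).symm
    have h2 := Int.lt_floor_add_one (Q * t - s)
    exact ⟨_, ⟨h1, h2⟩, h1, h2⟩

lemma isOpenPER_gridRel {α ι : Type*} [TopologicalSpace α] {Q : ℝ} (hQ : 0 < Q) (s : ℝ)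
    (D : Finset ι) (h : ι → α → ℝ) (hc : ∀ d ∈ D, Continuous (h d)) :
    IsOpenPER (fun x y => ∀ d ∈ D, |h d x - h d y| < 1 / Q)
      (fun x y => ∀ d ∈ D, GridRel Q s (h d x) (h d y)) where
  symm _ _ hr d hd := (hr d hd).symm
  trans _ _ _ hr hr' d hd := (hr d hd).trans (hr' d hd)
  isOpen x := by
    have : {y | ∀ d ∈ D, GridRel Q s (h d x) (h d y)} =
        ⋂ d ∈ D, h d ⁻¹' {t | GridRel Q s (h d x) t} := by ext; simp
    rw [this]
    exact isOpen_biInter_finset fun d hd => (GridRel.isOpen Q s _).preimage (hc d hd)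
  sub _ _ hr d hd := (hr d hd).abs_sub_lt hQ

/-- Grids with distinct shifts in `(0, 1)` are disjoint: the coordinates of a point which lie on
grids with different shifts are different, and they do not vanish. -/
lemma exists_injOn_of_gridPoints {ι κ : Type*} {Q : ℝ} {s : κ → ℝ} (hs : Function.Injective s)
    (hs01 : ∀ i, 0 < s i ∧ s i < 1) (t : ι → ℝ) (D : Finset ι) (I : Finset κ)
    (hI : ∀ i ∈ I, ¬ ∀ d ∈ D, GridRel Q (s i) (t d) (t d)) :
    ∃ f : I → ι, Function.Injective f ∧ ∀ i : I, f i ∈ D ∧ t (f i) ≠ 0 ∧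
      ∃ v : ℤ, Q * t (f i) = s i + v := by
  have key : ∀ i : I, ∃ d, d ∈ D ∧ t d ≠ 0 ∧ ∃ v : ℤ, Q * t d = s i + v := by
    rintro ⟨i, hi⟩
    have := hI i hi
    push Not at this
    obtain ⟨d, hd, hn⟩ := this
    rw [GridRel.self_iff] at hn
    push Not at hn
    obtain ⟨v, hv⟩ := hn
    refine ⟨d, hd, fun h0 => ?_, v, by linarith⟩
    rw [h0, mul_zero, zero_sub] at hv
    have h1 : (-1 : ℝ) < v := by linarith [(hs01 i).2]
    have h2 : (v : ℝ) < 0 := by linarith [(hs01 i).1]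
    norm_cast at h1 h2
    omega
  choose f hf using key
  refine ⟨f, fun i j hij => ?_, hf⟩
  obtain ⟨-, -, v, hv⟩ := hf i
  obtain ⟨-, -, w, hw⟩ := hf j
  rw [hij, hw] at hv
  have h1 : (v : ℝ) - w < 1 := by linarith [(hs01 i).1, (hs01 j).2]
  have h2 : (-1 : ℝ) < v - w := by linarith [(hs01 i).2, (hs01 j).1]
  norm_cast at h1 h2
  have hvw : v = w := by omega
  subst hvw
  exact Subtype.ext (hs (by linarith))

/-- The shifts used for the coordinate grids. -/
noncomputable def gridShift (i : ℕ) : ℝ := 1 / ((i : ℝ) + 2)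

lemma gridShift_injective : Function.Injective gridShift := by
  intro i j h
  have hi : (0 : ℝ) < (i : ℝ) + 2 := by positivity
  have hj : (0 : ℝ) < (j : ℝ) + 2 := by positivity
  simp only [gridShift] at h
  rw [div_eq_div_iff hi.ne' hj.ne'] at h
  have : (i : ℝ) = j := by linarith
  exact_mod_cast this

lemma gridShift_mem (i : ℕ) : 0 < gridShift i ∧ gridShift i < 1 := by
  have hi : (0 : ℝ) ≤ i := by positivity
  refine ⟨by unfold gridShift; positivity, ?_⟩
  rw [gridShift, div_lt_one (by positivity)]
  linarith

/-- Real functions at most `a` of which are nonzero at any given point define covers in which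
each point is missed at most `a` times. -/
lemma HasCovers.of_sparse {α ι : Type*} [TopologicalSpace α] {Q : ℝ} (hQ : 0 < Q)
    (D : Finset ι) (h : ι → α → ℝ) (hc : ∀ d ∈ D, Continuous (h d)) {a : ℕ}
    (ha : ∀ x, ∃ S : Finset ι, S.card ≤ a ∧ ∀ d ∈ D, h d x ≠ 0 → d ∈ S) :
    HasCovers (fun x y => ∀ d ∈ D, |h d x - h d y| < 1 / Q) a := by
  classical
  intro k
  refine ⟨fun i x y => ∀ d ∈ D, GridRel Q (gridShift i) (h d x) (h d y),
    fun i => isOpenPER_gridRel hQ _ D h hc, fun x => ?_⟩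
  refine ⟨Finset.univ.filter fun i : Fin k => ¬ ∀ d ∈ D, GridRel Q (gridShift i) (h d x) (h d x),
    ?_, fun i hi => by simpa using hi⟩
  obtain ⟨S, hS, hS'⟩ := ha x
  obtain ⟨f, hf, hf'⟩ := exists_injOn_of_gridPoints (Q := Q) (s := fun i : Fin k => gridShift i)
    (fun i j hij => Fin.ext (gridShift_injective hij)) (fun i => gridShift_mem i)
    (fun d => h d x) D _ (fun i hi => (Finset.mem_filter.1 hi).2)
  refine le_trans ?_ hS
  rw [← Fintype.card_coe, ← Finset.card_univ]
  exact Finset.card_le_card_of_injOn f (fun i _ => hS' _ (hf' i).1 (hf' i).2.1) hf.injOn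

/-! ### Passing between covers and maps to complexes -/

/-- On a finite simplicial complex of dimension `a` there are fine covers in which each point is
missed at most `a` times. -/
lemma HasCovers.of_realization {α : Type*} [TopologicalSpace α] {n a : ℕ}
    {K : PreAbstractSimplicialComplex (Fin n)} (hK : ∀ s ∈ K.faces, s.card ≤ a + 1)
    {F : α → realization K} (hF : Continuous F) {Q : ℕ} (hQ : 0 < Q) :
    HasCovers (fun x y => ∀ d, |(F x).1 d - (F y).1 d| < 1 / (Q : ℝ)) a := by
  classical
  intro k
  have hQ' : (0 : ℝ) < Q := by exact_mod_cast hQ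
  -- Distinct shifts below `1 / (a + 1)`, so that any `a + 1` of them have a sum strictly between
  -- `0` and `1`.
  let s : Fin k → ℝ := fun i => ((i : ℝ) + 1) / ((a + 1) * (k + 1))
  have hpos : (0 : ℝ) < (a + 1) * (k + 1) := by positivity
  have hs0 : ∀ i, 0 < s i := fun i => by simp only [s]; positivity
  have hs1 : ∀ i, s i < 1 / (a + 1) := by
    intro i
    have : ((i : ℕ) : ℝ) < k := by exact_mod_cast i.2
    rw [div_lt_div_iff₀ hpos (by positivity)]
    nlinarith [(by positivity : (0 : ℝ) ≤ a)]
  have hs2 : ∀ i, s i < 1 := fun i => (hs1 i).trans_le (by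
    rw [div_le_one (by positivity)]; linarith [(by positivity : (0 : ℝ) ≤ a)])
  have hsi : Function.Injective s := by
    intro i j hij
    simp only [s] at hij
    rw [div_left_inj' hpos.ne'] at hij
    have : ((i : ℕ) : ℝ) = (j : ℕ) := by linarith
    exact Fin.ext (by exact_mod_cast this)
  have hc : ∀ d ∈ (Finset.univ : Finset (Fin n)), Continuous fun x => (F x).1 d :=
    fun d _ => (continuous_apply d).comp (continuous_subtype_val.comp hF)
  refine ⟨fun i x y => ∀ d ∈ (Finset.univ : Finset (Fin n)), GridRel Q (s i) ((F x).1 d)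
    ((F y).1 d), fun i => (isOpenPER_gridRel hQ' _ _ (fun d x => (F x).1 d) hc).mono
      (fun x y h d => h d (Finset.mem_univ d)), fun x => ?_⟩
  set I := Finset.univ.filter fun i : Fin k =>
    ¬ ∀ d ∈ (Finset.univ : Finset (Fin n)), GridRel Q (s i) ((F x).1 d) ((F x).1 d) with hI
  refine ⟨I, ?_, fun i hi => by simpa [hI] using hi⟩
  obtain ⟨f, hf, hf'⟩ := exists_injOn_of_gridPoints (Q := Q) hsi (fun i => ⟨hs0 i, hs2 i⟩)
    (fun d => (F x).1 d) Finset.univ I (fun i hi => (Finset.mem_filter.1 hi).2)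
  obtain ⟨hx, S, hSK, hS⟩ := (F x).2
  by_contra! hcard
  have hle : (Finset.univ.image f).card = I.card := by
    rw [Finset.card_image_of_injective _ hf, Finset.card_univ, Fintype.card_coe]
  have hsub : Finset.univ.image f ⊆ S := by
    intro d hd
    obtain ⟨i, -, rfl⟩ := Finset.mem_image.1 hd
    exact hS _ (hf' i).2.1
  have himg : Finset.univ.image f = S :=
    Finset.eq_of_subset_of_card_le hsub ((hK S hSK).trans (by omega))
  have hIc : I.card = a + 1 := le_antisymm
    (by rw [← hle, himg]; exact hK S hSK) hcard
  have hsum : ∑ i : I, (F x).1 (f i) = 1 := by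
    rw [← hx.2, ← Finset.sum_image (g := f) (f := fun d => (F x).1 d) (fun i _ j _ h => hf h), himg]
    refine Finset.sum_subset (Finset.subset_univ _) fun d _ hd => ?_
    by_contra h0
    exact hd (hS d h0)
  -- If `a + 1` grids were hit, the corresponding coordinates would be the whole support and sum to
  -- `1`. Multiplying by the integer `Q` makes the sum of the `a + 1` shifts an integer, which is
  -- impossible. This saves one dimension against counting nonzero coordinates.
  choose v hv using fun i => (hf' i).2.2
  have hZ : ∑ i : I, s i = ((Q - ∑ i : I, v i : ℤ) : ℝ) := by
    push_cast
    rw [← mul_one (Q : ℝ), ← hsum, Finset.mul_sum, ← Finset.sum_sub_distrib]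
    exact Finset.sum_congr rfl fun i _ => by linarith [hv i]
  have hne : (Finset.univ : Finset I).Nonempty := by
    rw [← Finset.card_pos, Finset.card_univ, Fintype.card_coe]
    omega
  have h0 : 0 < ∑ i : I, s i := Finset.sum_pos (fun i _ => hs0 i) hne
  have h1 : ∑ i : I, s i < 1 := by
    calc ∑ i : I, s i < ∑ i : I, (1 / ((a : ℝ) + 1)) :=
          Finset.sum_lt_sum_of_nonempty hne fun i _ => hs1 i
      _ = 1 := by
          rw [Finset.sum_const, Finset.card_univ, Fintype.card_coe, hIc, nsmul_eq_mul]
          push_cast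
          field_simp
  rw [hZ] at h0 h1
  norm_cast at h0 h1
  omega

/-- By compactness the pairs outside the open relation `E` have images at distance at least some `η
> 0`, so a cover of the complex of mesh below `η` pulls back to an `E`-small one. -/
lemma HasComplexMap.hasCovers {α : Type*} [TopologicalSpace α] [CompactSpace α]
    {E : α → α → Prop} (hE : IsOpen {p : α × α | E p.1 p.2}) {a : ℕ} (h : HasComplexMap E a) :
    HasCovers E a := by
  obtain ⟨n, K, hK, F, hF, hFE⟩ := h
  have hcpt : IsCompact {p : α × α | E p.1 p.2}ᶜ := hE.isClosed_compl.isCompact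
  have hcont : Continuous fun p : α × α => dist (F p.1) (F p.2) := by fun_prop
  obtain ⟨η, hη, hη'⟩ := hcpt.exists_forall_le' hcont.continuousOn (a := 0) (fun p hp =>
    dist_pos.2 fun he => hp (hFE _ _ he))
  obtain ⟨q, hq⟩ := exists_nat_one_div_lt hη
  refine (HasCovers.of_realization hK hF (Nat.succ_pos q)).mono fun x y hxy => ?_
  by_contra hn
  refine absurd (hη' (x, y) hn) (not_le.2 (lt_of_le_of_lt ?_ hq))
  rw [Subtype.dist_eq, dist_pi_le_iff (by positivity)]
  intro d
  rw [Real.dist_eq]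
  exact_mod_cast (hxy d).le

/-- Map to the nerve of a finite subcover by a partition of unity. Sets of one colour are disjoint,
so a simplex has at most one vertex of each of the `a + 1` colours. -/
lemma HasCover.hasComplexMap {α : Type*} [TopologicalSpace α] [CompactSpace α] [T2Space α]
    {E : α → α → Prop} {a : ℕ} (h : HasCover E a) : HasComplexMap E a := by
  classical
  obtain ⟨r, hr, hx⟩ := h
  choose c hc using hx
  obtain ⟨t, ht⟩ := isCompact_univ.elim_finite_subcover (fun x : α => {y | r (c x) x y})
    (fun x => (hr (c x)).isOpen x) (fun x _ => mem_iUnion.2 ⟨x, hc x⟩)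
  -- Vertices are pairs of a colour and a class, not points, so that different representatives of
  -- one class give the same vertex.
  let T : Finset (Fin (a + 1) × Set α) := t.image fun x => (c x, {y | r (c x) x y})
  let e := T.equivFin
  let p : Fin T.card → Fin (a + 1) × Set α := fun k => (e.symm k).1
  have hp : ∀ k, ∃ x, (p k).2 = {y | r (p k).1 x y} := by
    intro k
    obtain ⟨x, -, hx⟩ := Finset.mem_image.1 (e.symm k).2
    exact ⟨x, by rw [show p k = _ from hx.symm]⟩
  have hinj : ∀ k k' y, y ∈ (p k).2 → y ∈ (p k').2 → (p k).1 = (p k').1 → k = k' := by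
    intro k k' y h1 h2 h3
    obtain ⟨x, hx⟩ := hp k
    obtain ⟨x', hx'⟩ := hp k'
    rw [hx] at h1
    rw [hx'] at h2
    have h1' : r (p k').1 x y := by rw [← h3]; exact h1
    have h2' : r (p k').1 x' y := h2
    have hxx := (hr _).trans _ _ _ h1' ((hr _).symm _ _ h2')
    have hset : (p k).2 = (p k').2 := by
      rw [hx, hx', h3]
      ext z
      exact ⟨fun hz => (hr _).trans _ _ _ ((hr _).symm _ _ hxx) hz,
        fun hz => (hr _).trans _ _ _ hxx hz⟩
    exact e.symm.injective (Subtype.ext (Prod.ext h3 hset))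
  have hEp : ∀ k y z, y ∈ (p k).2 → z ∈ (p k).2 → E y z := by
    intro k y z hy hz
    obtain ⟨x, hx⟩ := hp k
    rw [hx] at hy hz
    exact (hr _).sub _ _ ((hr _).trans _ _ _ ((hr _).symm _ _ hy) hz)
  obtain ⟨f, hf⟩ := PartitionOfUnity.exists_isSubordinate (isClosed_univ (X := α))
    (fun k => (p k).2)
    (fun k => by obtain ⟨x, hx⟩ := hp k; rw [hx]; exact (hr _).isOpen x)
    (fun y _ => by
      obtain ⟨x, hx⟩ := mem_iUnion.1 (ht (mem_univ y))
      obtain ⟨hxt, hxy⟩ := mem_iUnion.1 hx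
      refine mem_iUnion.2 ⟨e ⟨(c x, {y | r (c x) x y}), Finset.mem_image_of_mem _ hxt⟩, ?_⟩
      simpa [p] using hxy)
  have hsupp : ∀ k y, f k y ≠ 0 → y ∈ (p k).2 := fun k y hy => hf k (subset_tsupport _ hy)
  have hsum : ∀ y, ∑ k, f k y = 1 := fun y => by
    rw [← finsum_eq_sum_of_fintype]; exact f.sum_eq_one (mem_univ y)
  let K : PreAbstractSimplicialComplex (Fin T.card) :=
    { faces := {s | s.Nonempty ∧ ∀ k ∈ s, ∀ k' ∈ s, (p k).1 = (p k').1 → k = k'}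
      isRelLowerSet_faces := fun s hs => ⟨hs.1, fun s' hs' hne =>
        ⟨hne, fun k hk k' hk' => hs.2 k (hs' hk) k' (hs' hk')⟩⟩ }
  have hne : ∀ y, ∃ k, f k y ≠ 0 := by
    intro y
    by_contra! h0
    have := hsum y
    simp [h0] at this
  have hmem : ∀ y, (fun k => f k y) ∈ realization K := by
    intro y
    refine ⟨⟨fun k => f.nonneg k y, hsum y⟩, Finset.univ.filter fun k => f k y ≠ 0, ⟨?_, ?_⟩, ?_⟩
    · obtain ⟨k, hk⟩ := hne y
      exact ⟨k, by simpa using hk⟩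
    · intro k hk k' hk'
      exact hinj k k' y (hsupp k y (Finset.mem_filter.1 hk).2)
        (hsupp k' y (Finset.mem_filter.1 hk').2)
    · intro k hk
      simpa using hk
  refine ⟨T.card, K, fun s hs => ?_, fun y => ⟨fun k => f k y, hmem y⟩, ?_, ?_⟩
  · have := Finset.card_le_card_of_injOn (s := s) (t := Finset.univ) (fun k => (p k).1)
      (fun _ _ => Finset.mem_coe.2 (Finset.mem_univ _)) (fun k hk k' hk' => hs.2 k hk k' hk')
    simpa using this
  · exact Continuous.subtype_mk (continuous_pi fun k => (f k).continuous) _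
  · intro y z hyz
    obtain ⟨k, hk⟩ := hne y
    have hk' : f k z ≠ 0 := by
      have hfk : f k y = f k z := congrFun (congrArg Subtype.val hyz) k
      rwa [← hfk]
    exact hEp k y z (hsupp k y hk) (hsupp k z hk')

/-- The detour through a complex turns `a + 1` colours into arbitrarily many. -/
lemma HasCover.hasCovers {α : Type*} [TopologicalSpace α] [CompactSpace α] [T2Space α]
    {E : α → α → Prop} (hE : IsOpen {p : α × α | E p.1 p.2}) {a : ℕ} (h : HasCover E a) :
    HasCovers E a :=
  h.hasComplexMap.hasCovers hE

/-! ### Compatible metrics and Bowen metrics -/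

/-- The relation `d_N(x, y) < ε`. -/
def BowenRel {X : Type*} (d : X → X → ℝ) (T : X → X) (N : ℕ) (ε : ℝ) (x y : X) : Prop :=
  ∀ n < N, d (T^[n] x) (T^[n] y) < ε

lemma bowenMetric_lt_iff {X : Type*} {d : X → X → ℝ} {T : X → X} {N : ℕ} {ε : ℝ}
    (hε : 0 < ε) {x y : X} :
    bowenMetric d T N x y < ε ↔ BowenRel d T N ε x y := by
  constructor
  · intro h n hn
    exact (le_ciSup (f := fun n : Fin N => d (T^[n] x) (T^[n] y)) (Set.finite_range _).bddAbove
      ⟨n, hn⟩).trans_lt h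
  · intro h
    rcases isEmpty_or_nonempty (Fin N) with hN | hN
    · rw [bowenMetric, Real.iSup_of_isEmpty]
      exact hε
    · obtain ⟨n, hn⟩ := exists_eq_ciSup_of_finite (f := fun n : Fin N => d (T^[n] x) (T^[n] y))
      rw [bowenMetric, ← hn]
      exact h n n.2

section Metric

variable {X : Type*} [TopologicalSpace X] {d : X → X → ℝ}

lemma IsCompatibleMetric.nonneg (hd : IsCompatibleMetric d) (x y : X) : 0 ≤ d x y := by
  have h1 := hd.triangle x y x
  rw [hd.self, hd.comm y x] at h1
  linarith

lemma IsCompatibleMetric.isOpen_ball (hd : IsCompatibleMetric d) (x : X) (ε : ℝ) :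
    IsOpen {y | d x y < ε} := by
  rw [hd.isOpen_iff]
  intro y hy
  refine ⟨ε - d x y, sub_pos.2 hy, fun z hz => ?_⟩
  have := hd.triangle x y z
  show d x z < ε
  linarith

lemma IsCompatibleMetric.continuous (hd : IsCompatibleMetric d) :
    Continuous fun p : X × X => d p.1 p.2 := by
  rw [continuous_iff_continuousAt]
  rintro ⟨x, y⟩
  rw [Metric.continuousAt_iff']
  intro ε hε
  have h1 := (hd.isOpen_ball x (ε / 2)).mem_nhds (x := x) (by simp [hd.self, hε])
  have h2 := (hd.isOpen_ball y (ε / 2)).mem_nhds (x := y) (by simp [hd.self, hε])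
  filter_upwards [prod_mem_nhds h1 h2] with ⟨x', y'⟩ ⟨hx', hy'⟩
  change d x x' < _ at hx'
  change d y y' < _ at hy'
  have a1 := hd.triangle x x' y
  have a2 := hd.triangle x' y' y
  have a3 := hd.triangle x' x y'
  have a4 := hd.triangle x y y'
  rw [hd.comm x' x] at a3
  rw [hd.comm y' y] at a2
  rw [Real.dist_eq, abs_lt]
  constructor <;> linarith

/-- On a compact space, the sets `{d < ε}` form a basis of the neighbourhoods of the diagonal. -/
lemma IsCompatibleMetric.exists_lt_imp [CompactSpace X] (hd : IsCompatibleMetric d)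
    {E : X → X → Prop} (hE : IsOpen {p : X × X | E p.1 p.2}) (hrefl : ∀ x, E x x) :
    ∃ ε > 0, ∀ x y, d x y < ε → E x y := by
  have hcpt : IsCompact {p : X × X | E p.1 p.2}ᶜ := hE.isClosed_compl.isCompact
  obtain ⟨η, hη, hη'⟩ := hcpt.exists_forall_le' hd.continuous.continuousOn (a := 0) (fun p hp => by
    refine lt_of_le_of_ne (hd.nonneg _ _) fun h0 => hp ?_
    change E _ _
    rw [hd.eq_of_zero _ _ h0.symm]
    exact hrefl _)
  refine ⟨η, hη, fun x y hxy => ?_⟩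
  by_contra hn
  exact absurd (hη' (x, y) hn) (not_le.2 hxy)

lemma exists_isCompatibleMetric (X : Type*) [TopologicalSpace X] [MetrizableSpace X] :
    ∃ d : X → X → ℝ, IsCompatibleMetric d := by
  let _ := metrizableSpaceMetric X
  refine ⟨dist, dist_self, dist_comm, dist_triangle, fun _ _ => eq_of_dist_eq_zero, fun s => ?_⟩
  rw [Metric.isOpen_iff]
  refine forall₂_congr fun x _ => exists_congr fun ε => and_congr_right fun _ => ?_
  exact forall_congr' fun y => by rw [Metric.mem_ball, dist_comm]

lemma isOpen_bowenRel (hd : IsCompatibleMetric d) {T : X → X} (hT : Continuous T) (N : ℕ) (ε : ℝ) :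
    IsOpen {p : X × X | BowenRel d T N ε p.1 p.2} := by
  have : {p : X × X | BowenRel d T N ε p.1 p.2} =
      ⋂ n ∈ Finset.range N, {p : X × X | d (T^[n] p.1) (T^[n] p.2) < ε} := by
    ext; simp [BowenRel]
  rw [this]
  refine isOpen_biInter_finset fun n _ => isOpen_lt ?_ continuous_const
  exact hd.continuous.comp
    (((hT.iterate n).comp continuous_fst).prodMk ((hT.iterate n).comp continuous_snd))

/-- For compact sets, an `ε`-embedding is a map to a complex with `ε`-small fibres. -/
lemma hasEpsEmbedding_iff [CompactSpace X] [T2Space X] (hd : IsCompatibleMetric d)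
    {T : X → X} (hT : Continuous T) {N : ℕ} {ε : ℝ} (hε : 0 < ε) {A : Set X} (hA : IsClosed A)
    {n : ℕ} : HasEpsEmbedding (bowenMetric d T N) ε A n ↔
      HasComplexMap (fun x y : A => BowenRel d T N ε x y) n := by
  have : CompactSpace A := isCompact_iff_compactSpace.1 hA.isCompact
  constructor
  · rintro ⟨k, K, hK, f, hf, hdiam⟩
    refine ⟨k, K, hK, f, hf, fun x y hxy => ?_⟩
    change BowenRel d T N ε x y
    rw [← bowenMetric_lt_iff hε, ← ENNReal.ofReal_lt_ofReal_iff hε]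
    refine lt_of_le_of_lt ?_ (hdiam (f x))
    have hx : (x : X) ∈ Subtype.val '' (f ⁻¹' {f x}) := ⟨x, rfl, rfl⟩
    have hy : (y : X) ∈ Subtype.val '' (f ⁻¹' {f x}) := ⟨y, hxy.symm, rfl⟩
    exact (le_iSup₂_of_le (x : X) hx (le_iSup₂_of_le (y : X) hy le_rfl) :
      _ ≤ diamWith (bowenMetric d T N) _)
  · rintro ⟨k, K, hK, F, hF, hFE⟩
    refine ⟨k, K, hK, F, hF, fun p => ?_⟩
    have hcpt : IsCompact {q : A × A | F q.1 = F q.2} :=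
      (isClosed_eq (hF.comp continuous_fst) (hF.comp continuous_snd)).isCompact
    -- The diameter is a supremum and must be strictly below `ε`, so pointwise bounds are improved
    -- by compactness to a uniform `c < ε`.
    obtain ⟨c, hc0, hcε, hc⟩ : ∃ c, 0 < c ∧ c < ε ∧ ∀ q ∈ {q : A × A | F q.1 = F q.2},
        bowenMetric d T N q.1 q.2 ≤ c := by
      refine hcpt.induction_on (p := fun S => ∃ c, 0 < c ∧ c < ε ∧ ∀ q ∈ S,
        bowenMetric d T N (q.1 : X) q.2 ≤ c) ⟨ε / 2, by linarith, by linarith, by simp⟩ ?_ ?_ ?_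
      · rintro S S' hS ⟨c, h0, h1, h2⟩
        exact ⟨c, h0, h1, fun q hq => h2 q (hS hq)⟩
      · rintro S S' ⟨c, h0, h1, h2⟩ ⟨c', h0', h1', h2'⟩
        refine ⟨max c c', lt_max_of_lt_left h0, max_lt h1 h1', ?_⟩
        rintro q (hq | hq)
        · exact le_max_of_le_left (h2 q hq)
        · exact le_max_of_le_right (h2' q hq)
      · intro q hq
        have hlt : max (bowenMetric d T N (q.1 : X) q.2) 0 < ε :=
          max_lt ((bowenMetric_lt_iff hε).2 (hFE _ _ hq)) hε
        obtain ⟨c, hc1, hc2⟩ := exists_between hlt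
        have hc0 : 0 < c := (le_max_right _ _).trans_lt hc1
        refine ⟨{q : A × A | BowenRel d T N c q.1 q.2}, mem_nhdsWithin_of_mem_nhds ?_,
          c, hc0, hc2, fun q hq => ((bowenMetric_lt_iff hc0).2 hq).le⟩
        refine ((isOpen_bowenRel hd hT N c).preimage (f := fun q : A × A => ((q.1 : X), (q.2 : X)))
          (by fun_prop)).mem_nhds ?_
        exact (bowenMetric_lt_iff hc0).1 ((le_max_left _ _).trans_lt hc1)
    refine lt_of_le_of_lt ?_ ((ENNReal.ofReal_lt_ofReal_iff hε).2 hcε)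
    refine iSup₂_le fun x hx => iSup₂_le fun y hy => ENNReal.ofReal_le_ofReal ?_
    obtain ⟨x, hx, rfl⟩ := hx
    obtain ⟨y, hy, rfl⟩ := hy
    exact hc (x, y) ((hx : F x = p).trans (hy : F y = p).symm)

lemma widim_le_iff_hasEpsEmbedding {d : X → X → ℝ} {ε : ℝ} {A : Set X} {n : ℕ} :
    widim d ε A ≤ n ↔ HasEpsEmbedding d ε A n := by
  constructor
  · intro h
    have h' : widim d ε A < (n + 1 : ℕ) := h.trans_lt (by exact_mod_cast Nat.lt_succ_self n)
    rw [widim, iInf_lt_iff] at h'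
    obtain ⟨m, hm⟩ := h'
    rw [iInf_lt_iff] at hm
    obtain ⟨⟨k, K, hK, hf⟩, hmn⟩ := hm
    have : m < n + 1 := by exact_mod_cast hmn
    exact ⟨k, K, fun s hs => (hK s hs).trans (by omega), hf⟩
  · intro h
    exact iInf₂_le n h

/-- The width dimension of compact sets in terms of coloured covers. -/
theorem widim_le_iff [CompactSpace X] [T2Space X] (hd : IsCompatibleMetric d)
    {T : X → X} (hT : Continuous T) {N : ℕ} {ε : ℝ} (hε : 0 < ε) {A : Set X} (hA : IsClosed A)
    {n : ℕ} : widim (bowenMetric d T N) ε A ≤ n ↔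
      HasCovers (fun x y : A => BowenRel d T N ε x y) n := by
  have : CompactSpace A := isCompact_iff_compactSpace.1 hA.isCompact
  rw [widim_le_iff_hasEpsEmbedding, hasEpsEmbedding_iff hd hT hε hA]
  exact ⟨fun h => HasComplexMap.hasCovers (E := fun x y : A => BowenRel d T N ε x y)
    ((isOpen_bowenRel hd hT N ε).preimage
    (f := fun q : A × A => ((q.1 : X), (q.2 : X))) (by fun_prop)) h,
    fun h => h.hasCover.hasComplexMap⟩

theorem widim_univ_le_iff [CompactSpace X] [T2Space X] (hd : IsCompatibleMetric d)
    {T : X → X} (hT : Continuous T) {N : ℕ} {ε : ℝ} (hε : 0 < ε)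
    {n : ℕ} : widim (bowenMetric d T N) ε univ ≤ n ↔ HasCovers (BowenRel d T N ε) n := by
  rw [widim_le_iff hd hT hε isClosed_univ]
  exact ⟨fun h => h.comap (f := fun x => ⟨x, mem_univ x⟩) (by fun_prop),
    fun h => h.comap continuous_subtype_val⟩

/-- Compact spaces have finite coloured covers. -/
lemma exists_hasCovers [CompactSpace X] [T2Space X] {E : X → X → Prop}
    (hE : IsOpen {p : X × X | E p.1 p.2}) (hrefl : ∀ x, E x x) : ∃ n, HasCovers E n := by
  classical
  have hU : ∀ x : X, ∃ U : Set X, IsOpen U ∧ x ∈ U ∧ ∀ y ∈ U, ∀ z ∈ U, E y z := by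
    intro x
    obtain ⟨U, V, hU, hV, hxU, hxV, hUV⟩ := isOpen_prod_iff.1 hE x x (hrefl x)
    exact ⟨U ∩ V, hU.inter hV, ⟨hxU, hxV⟩, fun y hy z hz => hUV (Set.mk_mem_prod hy.1 hz.2)⟩
  choose U hUo hxU hUE using hU
  obtain ⟨t, ht⟩ := isCompact_univ.elim_finite_subcover U hUo (fun x _ => mem_iUnion.2 ⟨x, hxU x⟩)
  let V : Fin (t.card + 1) → Set X := fun i =>
    if h : (i : ℕ) < t.card then U (t.equivFin.symm ⟨i, h⟩) else ∅
  have hVo : ∀ i, IsOpen (V i) := fun i => by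
    simp only [V]; split_ifs
    · exact hUo _
    · exact isOpen_empty
  have hVE : ∀ i, ∀ y ∈ V i, ∀ z ∈ V i, E y z := fun i => by
    simp only [V]; split_ifs
    · exact hUE _
    · simp
  refine ⟨t.card, HasCover.hasCovers hE ⟨fun i x y => x ∈ V i ∧ y ∈ V i, fun i =>
    ⟨fun _ _ h => ⟨h.2, h.1⟩, fun _ _ _ h h' => ⟨h.1, h'.2⟩,
      fun x => isOpen_const.and (hVo i), fun x y h => hVE i x h.1 y h.2⟩, fun x => ?_⟩⟩
  obtain ⟨y, hy⟩ := mem_iUnion.1 (ht (mem_univ x))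
  obtain ⟨hyt, hxy⟩ := mem_iUnion.1 hy
  refine ⟨(t.equivFin ⟨y, hyt⟩).castSucc, ?_⟩
  have : x ∈ V (t.equivFin ⟨y, hyt⟩).castSucc := by simpa [V] using hxy
  exact ⟨this, this⟩

end Metric

/-! ### Existence of mean dimension -/

/-- The upper growth rate of a sequence of extended natural numbers. -/
noncomputable def growthRate (w : ℕ → ℕ∞) : ℝ≥0∞ :=
  limsup (fun N : ℕ => (w N : ℝ≥0∞) / (N : ℝ≥0∞)) atTop

lemma growthRate_mono {w w' : ℕ → ℕ∞} (h : ∀ N, w N ≤ w' N) : growthRate w ≤ growthRate w' :=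
  limsup_le_limsup (Eventually.of_forall fun N =>
    ENNReal.div_le_div_right (by exact_mod_cast h N) _)

/-- Fekete's lemma. -/
lemma tendsto_growthRate {w : ℕ → ℕ∞} (hfin : ∀ N, w N ≠ ⊤)
    (hsub : ∀ M N, w (M + N) ≤ w M + w N) :
    Tendsto (fun N : ℕ => (w N : ℝ≥0∞) / (N : ℝ≥0∞)) atTop (𝓝 (growthRate w)) := by
  choose u hu using fun N => ENat.ne_top_iff_exists.1 (hfin N)
  have hs : Subadditive (fun N => (u N : ℝ)) := by
    intro M N
    have := hsub M N
    rw [← hu, ← hu, ← hu] at this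
    beta_reduce
    exact_mod_cast this
  have ht := hs.tendsto_lim ⟨0, by rintro _ ⟨n, rfl⟩; positivity⟩
  have ht' := (ENNReal.continuous_ofReal.tendsto _).comp ht
  have heq : (fun N : ℕ => (w N : ℝ≥0∞) / (N : ℝ≥0∞)) =ᶠ[atTop]
      (ENNReal.ofReal ∘ fun N : ℕ => (u N : ℝ) / N) := by
    filter_upwards [eventually_gt_atTop 0] with N hN
    have hN' : (0 : ℝ) < N := by exact_mod_cast hN
    simp only [Function.comp_apply]
    rw [ENNReal.ofReal_div_of_pos hN', ENNReal.ofReal_natCast, ENNReal.ofReal_natCast, ← hu]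
    rfl
  have h := ht'.congr' heq.symm
  rwa [growthRate, h.limsup_eq]

lemma growthRate_le_of_le {w : ℕ → ℕ∞} {c C : ℝ} (h : ∀ N, ∃ a : ℕ, w N ≤ a ∧ (a : ℝ) ≤ c * N + C) :
    growthRate w ≤ ENNReal.ofReal c := by
  have ht : Tendsto (fun N : ℕ => ENNReal.ofReal (c + C / N)) atTop (𝓝 (ENNReal.ofReal c)) := by
    refine (ENNReal.continuous_ofReal.tendsto c).comp ?_
    simpa using tendsto_const_nhds.add (tendsto_const_div_atTop_nhds_zero_nat C)
  rw [← ht.limsup_eq]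
  refine limsup_le_limsup ?_
  filter_upwards [eventually_gt_atTop 0] with N hN
  have hN' : (0 : ℝ) < N := by exact_mod_cast hN
  obtain ⟨a, ha, hac⟩ := h N
  calc (w N : ℝ≥0∞) / N ≤ (a : ℝ≥0∞) / N := by
        gcongr
        exact_mod_cast ha
    _ = ENNReal.ofReal (a / N) := by
        rw [ENNReal.ofReal_div_of_pos hN', ENNReal.ofReal_natCast, ENNReal.ofReal_natCast]
    _ ≤ ENNReal.ofReal (c + C / N) := by
        refine ENNReal.ofReal_le_ofReal ?_
        rw [div_le_iff₀ hN', add_mul, div_mul_cancel₀ _ hN'.ne']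
        exact hac

lemma one_le_growthRate {w : ℕ → ℕ∞} (h : ∀ N : ℕ, (N : ℕ∞) ≤ w N) : 1 ≤ growthRate w := by
  have ht : Tendsto (fun _ : ℕ => (1 : ℝ≥0∞)) atTop (𝓝 1) := tendsto_const_nhds
  rw [← ht.limsup_eq]
  refine limsup_le_limsup ?_
  filter_upwards [eventually_gt_atTop 0] with N hN
  have hN' : (N : ℝ≥0∞) ≠ 0 := by exact_mod_cast hN.ne'
  rw [← ENNReal.div_self hN' (ENNReal.natCast_ne_top N)]
  gcongr
  exact_mod_cast (by exact_mod_cast h N : ((N : ℕ∞) : ℝ≥0∞) ≤ (w N : ℝ≥0∞))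

lemma widim_antitone {X : Type*} [TopologicalSpace X] {d : X → X → ℝ} {T : X → X} {N : ℕ}
    {ε ε' : ℝ} (h : ε ≤ ε') (A : Set X) :
    widim (bowenMetric d T N) ε' A ≤ widim (bowenMetric d T N) ε A := by
  refine le_iInf₂ fun n hn => ?_
  obtain ⟨k, K, hK, f, hf, hdiam⟩ := hn
  exact iInf₂_le n ⟨k, K, hK, f, hf, fun p => (hdiam p).trans_le (ENNReal.ofReal_le_ofReal h)⟩

section MeanDim

variable {X : Type*} [TopologicalSpace X] [CompactSpace X] [T2Space X] {d d' : X → X → ℝ}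
  {T : X → X}

lemma widim_ne_top (hd : IsCompatibleMetric d) (hT : Continuous T) {ε : ℝ} (hε : 0 < ε) (N : ℕ) :
    widim (bowenMetric d T N) ε univ ≠ ⊤ := by
  obtain ⟨n, hn⟩ := exists_hasCovers (isOpen_bowenRel hd hT N ε)
    (fun x k _ => by rw [hd.self]; exact hε)
  exact ne_top_of_le_ne_top (ENat.natCast_ne_top n) ((widim_univ_le_iff hd hT hε).2 hn)

/-- Intersect a cover for times `0, …, M - 1` with the pullback by `T^M` of one for times `0, …, N -
1`. -/
lemma widim_add_le (hd : IsCompatibleMetric d) (hT : Continuous T) {ε : ℝ} (hε : 0 < ε)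
    (M N : ℕ) : widim (bowenMetric d T (M + N)) ε univ ≤
      widim (bowenMetric d T M) ε univ + widim (bowenMetric d T N) ε univ := by
  obtain ⟨a, ha⟩ := ENat.ne_top_iff_exists.1 (widim_ne_top hd hT hε M)
  obtain ⟨b, hb⟩ := ENat.ne_top_iff_exists.1 (widim_ne_top hd hT hε N)
  have ha' := (widim_univ_le_iff hd hT hε).1 ha.ge
  have hb' := (widim_univ_le_iff hd hT hε).1 hb.ge
  rw [← ha, ← hb, ← Nat.cast_add, widim_univ_le_iff hd hT hε]
  refine (ha'.inf (hb'.comap (hT.iterate M))).mono fun x y hxy n hn => ?_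
  by_cases hnM : n < M
  · exact hxy.1 n hnM
  · have := hxy.2 (n - M) (by omega)
    rwa [← Function.iterate_add_apply, ← Function.iterate_add_apply, Nat.sub_add_cancel (by omega)]
      at this

/-- The mean dimension computed with the metric `d`. -/
noncomputable def mdimWith (d : X → X → ℝ) (T : X → X) : ℝ≥0∞ :=
  sSup ((fun ε => growthRate fun N => widim (bowenMetric d T N) ε univ) '' Ioi 0)

/-- The inner limit is Fekete's lemma; the growth rate is antitone in `ε`, so its limit at `0` is
the supremum. -/
lemma isMeanLimit_mdimWith (hd : IsCompatibleMetric d) (hT : Continuous T) :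
    IsMeanLimit (fun ε N => widim (bowenMetric d T N) ε univ) (mdimWith d T) := by
  have hanti : Antitone fun ε => growthRate fun N => widim (bowenMetric d T N) ε univ :=
    fun ε ε' h => growthRate_mono fun N => widim_antitone h _
  exact ⟨fun ε => growthRate fun N => widim (bowenMetric d T N) ε univ, fun ε hε =>
    tendsto_growthRate (widim_ne_top hd hT hε) (widim_add_le hd hT hε), hanti.tendsto_nhdsGT 0⟩

/-- A uniform comparison of the two metrics passes to the Bowen metrics for all `N` at once. -/
lemma mdimWith_le_mdimWith (hd : IsCompatibleMetric d) (hd' : IsCompatibleMetric d')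
    (hT : Continuous T) : mdimWith d T ≤ mdimWith d' T := by
  refine sSup_le ?_
  rintro _ ⟨ε, hε, rfl⟩
  obtain ⟨ε', hε', h⟩ := hd'.exists_lt_imp (E := fun x y => d x y < ε)
    (isOpen_lt hd.continuous continuous_const)
    (fun x => by rw [hd.self]; exact hε)
  refine le_sSup_of_le ⟨ε', hε', rfl⟩ (growthRate_mono fun N => ?_)
  obtain ⟨a, ha⟩ := ENat.ne_top_iff_exists.1 (widim_ne_top hd' hT hε' N)
  rw [← ha, widim_univ_le_iff hd hT hε]
  exact ((widim_univ_le_iff hd' hT hε').1 ha.ge).mono fun x y hxy n hn => h _ _ (hxy n hn)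

end MeanDim

/-- The mean dimension does not depend on the metric. -/
theorem isMeanDim_mdimWith (A : DynSystem) {d : A → A → ℝ} (hd : IsCompatibleMetric d) :
    IsMeanDim A (mdimWith d A.T) := by
  intro d' hd'
  rw [(mdimWith_le_mdimWith hd hd' A.T.continuous).antisymm
    (mdimWith_le_mdimWith hd' hd A.T.continuous)]
  exact isMeanLimit_mdimWith hd' A.T.continuous

lemma mdimWith_le {X : Type*} [TopologicalSpace X] [CompactSpace X] [T2Space X]
    {d : X → X → ℝ} {T : X → X} (hd : IsCompatibleMetric d) (hT : Continuous T) {c : ℝ}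
    (h : ∀ ε > 0, ∃ C : ℝ, ∀ N : ℕ, ∃ a : ℕ, HasCovers (BowenRel d T N ε) a ∧
      (a : ℝ) ≤ c * N + C) : mdimWith d T ≤ ENNReal.ofReal c := by
  refine sSup_le ?_
  rintro _ ⟨ε, hε, rfl⟩
  obtain ⟨C, hC⟩ := h ε hε
  refine growthRate_le_of_le (C := C) fun N => ?_
  obtain ⟨a, ha, hac⟩ := hC N
  exact ⟨a, (widim_univ_le_iff hd hT hε).2 ha, hac⟩

/-- A bound of arbitrarily small slope, uniform in the fibre, forces the inner limit to exist and
vanish for each `ε`; subadditivity is not needed. -/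
lemma isRelMeanDim_zero {A B : DynSystem} {π : A → B} (hπ : Continuous π)
    (h : ∀ d : A → A → ℝ, IsCompatibleMetric d → ∀ ε > 0, ∀ c > 0, ∃ C : ℝ, ∀ N : ℕ, ∃ a : ℕ,
      (a : ℝ) ≤ c * N + C ∧
        ∀ y : B, HasCovers (fun p q : π ⁻¹' {y} => BowenRel d A.T N ε p q) a) :
    IsRelMeanDim A B π 0 := by
  intro d hd
  refine ⟨fun _ => 0, fun ε hε => ?_, tendsto_const_nhds⟩
  set w : ℕ → ℕ∞ := fun N => ⨆ y : B, widim (bowenMetric d A.T N) ε (π ⁻¹' {y})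
  have hw : growthRate w ≤ 0 := by
    refine ENNReal.le_of_forall_pos_le_add fun c hc _ => ?_
    obtain ⟨C, hC⟩ := h d hd ε hε c hc
    have : growthRate w ≤ ENNReal.ofReal c := by
      refine growthRate_le_of_le (C := C) fun N => ?_
      obtain ⟨a, hac, ha⟩ := hC N
      exact ⟨a, iSup_le fun y => (widim_le_iff hd A.T.continuous hε
        (isClosed_singleton.preimage hπ)).2 (ha y), hac⟩
    simpa using this
  exact tendsto_of_le_liminf_of_limsup_le zero_le hw

/-! ### The covering dimension of cubes -/

/-- Lebesgue's covering theorem. -/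
theorem le_of_hasCovers_cube {N a : ℕ}
    (h : HasCovers (fun x y : Fin N → unitInterval => ∀ i, |(x i : ℝ) - y i| < 1) a) :
    N ≤ a := by
  classical
  by_contra! haN
  obtain ⟨r, hr, hx⟩ := h N
  have hcov : ∀ x, ∃ i, r i x x := by
    intro x
    obtain ⟨s, hs, hs'⟩ := hx x
    obtain ⟨i, hi⟩ : ∃ i, i ∉ s := by
      by_contra! hall
      rw [Finset.eq_univ_of_forall hall, Finset.card_univ, Fintype.card_fin] at hs
      omega
    exact ⟨i, hs' i hi⟩
  obtain ⟨δ, hδ, hball⟩ := lebesgue_number_lemma_of_metric (isCompact_univ)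
    (c := fun u : Fin N × (Fin N → unitInterval) => {y | r u.1 u.2 y})
    (fun u => (hr u.1).isOpen u.2)
    (fun x _ => by obtain ⟨i, hi⟩ := hcov x; exact mem_iUnion.2 ⟨(i, x), hi⟩)
  obtain ⟨m', hm'⟩ := exists_nat_one_div_lt hδ
  obtain ⟨m, rfl⟩ : ∃ m, m = m' + 1 := ⟨_, rfl⟩
  have hm0 : (0 : ℝ) < ((m' + 1 : ℕ) : ℝ) := by positivity
  let g : (Fin N → ℕ) → Fin N → unitInterval := fun p l =>
    ⟨min ((p l : ℝ) / (m' + 1 : ℕ)) 1, le_min (by positivity) zero_le_one, min_le_right _ _⟩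
  -- Colour `i` is paired with direction `i`: the label is `0` when the class of colour `i` of the
  -- grid point touches the face where coordinate `i` is `0`. Smallness keeps such a class away from
  -- the opposite face. A cube below the Lebesgue number lies in one class of some colour `i`, so
  -- label `i` is constant on it.
  let F : Fin N → (Fin N → ℕ) → ZMod 2 := fun i p =>
    if p i = 0 ∨ ∃ q : Fin N → unitInterval, (q i : ℝ) = 0 ∧ r i (g p) q then 0 else 1
  obtain ⟨x, hxm, hxF⟩ := exists_unit_cube_nonconstant (Nat.succ_pos m') F
    (fun i p hp => if_pos (Or.inl hp)) (fun i p hp => by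
      refine if_neg ?_
      rintro (h0 | ⟨q, hq, hrq⟩)
      · omega
      · have := (hr i).sub _ _ hrq i
        simp only [g, hp, hq] at this
        rw [div_self hm0.ne'] at this
        simp at this)
  obtain ⟨⟨i, y⟩, hi⟩ := hball (g x) (mem_univ _)
  have hmem : ∀ p : Fin N → ℕ, (∀ l, x l ≤ p l ∧ p l ≤ x l + 1) → r i y (g p) := by
    intro p hp
    refine hi (Metric.mem_ball.2 (lt_of_le_of_lt ?_ hm'))
    rw [dist_pi_le_iff (by positivity)]
    intro l
    rw [Subtype.dist_eq, Real.dist_eq]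
    have h1 : (x l : ℝ) / (m' + 1 : ℕ) ≤ (p l : ℝ) / (m' + 1 : ℕ) := by
      gcongr
      exact (hp l).1
    have h2 : (p l : ℝ) / (m' + 1 : ℕ) ≤ (x l : ℝ) / (m' + 1 : ℕ) + 1 / ((m' : ℝ) + 1) := by
      have : (p l : ℝ) ≤ x l + 1 := by exact_mod_cast (hp l).2
      rw [Nat.cast_succ, ← add_div]
      gcongr
    have h3 : (0 : ℝ) < 1 / ((m' : ℝ) + 1) := by positivity
    simp only [g]
    rw [abs_le]
    constructor <;> simp only [min_def] <;> split_ifs <;> linarith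
  have hF0 : ∀ p : Fin N → ℕ, (∀ l, x l ≤ p l ∧ p l ≤ x l + 1) →
      F i p = if ∃ q : Fin N → unitInterval, (q i : ℝ) = 0 ∧ r i y q then 0 else 1 := by
    intro p hp
    have hyp := hmem p hp
    refine if_congr ?_ rfl rfl
    constructor
    · rintro (h0 | ⟨q, hq, hrq⟩)
      · exact ⟨g p, by simp [g, h0], hyp⟩
      · exact ⟨q, hq, (hr i).trans _ _ _ hyp hrq⟩
    · rintro ⟨q, hq, hrq⟩
      exact Or.inr ⟨q, hq, (hr i).trans _ _ _ ((hr i).symm _ _ hyp) hrq⟩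
  obtain ⟨p, q, hp, hq, hne⟩ := hxF i
  exact hne ((hF0 p hp).trans (hF0 q hq).symm)

/-! ### Systems with coordinates -/

/-- The system `A` over `Z` is described by the base map `b` and the sequences
`(ψ j t p)_{t ∈ ℤ}` of reals on which the dynamics acts by the shift. -/
structure IsCoordinateSystem (A : DynSystem) (Z : DynSystem) {J : Type*} (ψ : J → ℤ → A → ℝ)
    (b : A → Z) : Prop where
  continuous_coord : ∀ j t, Continuous (ψ j t)
  continuous_base : Continuous b
  coord_map : ∀ j t p, ψ j t (A.T p) = ψ j (t + 1) p
  base_map : ∀ p, b (A.T p) = Z.T (b p)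
  ext : ∀ p q, (∀ j t, ψ j t p = ψ j t q) → b p = b q → p = q

lemma IsCoordinateSystem.coord_iterate {A Z : DynSystem} {J : Type*} {ψ : J → ℤ → A → ℝ}
    {b : A → Z} (h : IsCoordinateSystem A Z ψ b) (j : J) (t : ℤ) (n : ℕ) (p : A) :
    ψ j t (A.T^[n] p) = ψ j (t + n) p := by
  induction n generalizing p with
  | zero => simp
  | succ n ih => rw [Function.iterate_succ_apply, ih, h.coord_map, Nat.cast_succ, add_assoc]

lemma IsCoordinateSystem.base_iterate {A Z : DynSystem} {J : Type*} {ψ : J → ℤ → A → ℝ}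
    {b : A → Z} (h : IsCoordinateSystem A Z ψ b) (n : ℕ) (p : A) :
    b (A.T^[n] p) = Z.T^[n] (b p) := by
  induction n generalizing p with
  | zero => simp
  | succ n ih => rw [Function.iterate_succ_apply, ih, h.base_map, Function.iterate_succ_apply]

/-- A neighbourhood of the diagonal contains one defined by finitely many functions from a
separating family. -/
lemma exists_finite_coords {α Z I : Type*} [TopologicalSpace α] [CompactSpace α]
    [TopologicalSpace Z] [CompactSpace Z] [T2Space Z] [TotallyDisconnectedSpace Z]
    {ψ : I → α → ℝ} (hψ : ∀ i, Continuous (ψ i)) {b : α → Z} (hb : Continuous b)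
    (hinj : ∀ p q, (∀ i, ψ i p = ψ i q) → b p = b q → p = q)
    {E : α → α → Prop} (hE : IsOpen {p : α × α | E p.1 p.2}) (hrefl : ∀ x, E x x) :
    ∃ (F : Finset I) (η : ℝ) (𝒞 : Finset (Set Z)), 0 < η ∧ (∀ C ∈ 𝒞, IsClopen C) ∧
      ∀ p q, (∀ i ∈ F, |ψ i p - ψ i q| < η) → (∀ C ∈ 𝒞, (b p ∈ C ↔ b q ∈ C)) → E p q := by
  classical
  -- Pairs outside `E` are separated locally, by a coordinate or by a clopen set of `Z`; compactness
  -- leaves finitely many of these.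
  have hcpt : IsCompact {p : α × α | E p.1 p.2}ᶜ := hE.isClosed_compl.isCompact
  obtain ⟨F, η, 𝒞, hη, h𝒞, h⟩ := hcpt.induction_on
    (p := fun S => ∃ (F : Finset I) (η : ℝ) (𝒞 : Finset (Set Z)), 0 < η ∧ (∀ C ∈ 𝒞, IsClopen C) ∧
      ∀ p q, (∀ i ∈ F, |ψ i p - ψ i q| < η) → (∀ C ∈ 𝒞, (b p ∈ C ↔ b q ∈ C)) → (p, q) ∉ S)
    ⟨∅, 1, ∅, one_pos, by simp, by simp⟩
    (by
      rintro S S' hS ⟨F, η, 𝒞, hη, h𝒞, h⟩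
      exact ⟨F, η, 𝒞, hη, h𝒞, fun p q h1 h2 h3 => h p q h1 h2 (hS h3)⟩)
    (by
      rintro S S' ⟨F, η, 𝒞, hη, h𝒞, h⟩ ⟨F', η', 𝒞', hη', h𝒞', h'⟩
      refine ⟨F ∪ F', min η η', 𝒞 ∪ 𝒞', lt_min hη hη', ?_, ?_⟩
      · intro C hC
        rcases Finset.mem_union.1 hC with hC | hC
        · exact h𝒞 C hC
        · exact h𝒞' C hC
      · rintro p q h1 h2 (h3 | h3)
        · exact h p q (fun i hi => (h1 i (Finset.mem_union_left _ hi)).trans_le (min_le_left _ _))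
            (fun C hC => h2 C (Finset.mem_union_left _ hC)) h3
        · exact h' p q
            (fun i hi => (h1 i (Finset.mem_union_right _ hi)).trans_le (min_le_right _ _))
            (fun C hC => h2 C (Finset.mem_union_right _ hC)) h3)
    (by
      rintro ⟨p, q⟩ hpq
      have hne : p ≠ q := by
        rintro rfl
        exact hpq (hrefl p)
      by_cases hbpq : b p = b q
      · obtain ⟨i, hi⟩ : ∃ i, ψ i p ≠ ψ i q := by
          by_contra! hall
          exact hne (hinj p q hall hbpq)
        have hpos : 0 < |ψ i p - ψ i q| := abs_pos.2 (sub_ne_zero.2 hi)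
        refine ⟨{u | |ψ i p - ψ i q| / 2 < |ψ i u.1 - ψ i u.2|}, mem_nhdsWithin_of_mem_nhds ?_,
          {i}, |ψ i p - ψ i q| / 2, ∅, by positivity, by simp, ?_⟩
        · refine (isOpen_lt continuous_const ?_).mem_nhds ?_
          · exact (((hψ i).comp continuous_fst).sub ((hψ i).comp continuous_snd)).abs
          · exact half_lt_self hpos
        · intro p' q' h1 _ h3
          exact lt_asymm (h1 i (Finset.mem_singleton_self i)) h3
      · obtain ⟨C, hC, hpC, hqC⟩ := exists_isClopen_of_totally_separated hbpq
        refine ⟨{u | b u.1 ∈ C ∧ b u.2 ∈ Cᶜ}, mem_nhdsWithin_of_mem_nhds ?_,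
          ∅, 1, {C}, one_pos, by simpa using hC, ?_⟩
        · refine IsOpen.mem_nhds ?_ ⟨hpC, hqC⟩
          exact (hC.isOpen.preimage (hb.comp continuous_fst)).inter
            (hC.compl.isOpen.preimage (hb.comp continuous_snd))
        · intro p' q' _ h2 h3
          exact h3.2 ((h2 C (Finset.mem_singleton_self C)).1 h3.1))
  exact ⟨F, η, 𝒞, hη, h𝒞, fun p q h1 h2 => not_not.1 (h p q h1 h2)⟩

/-- Bowen balls contain cylinders. -/
lemma IsCoordinateSystem.exists_window {A Z : DynSystem} {J : Type*} {ψ : J → ℤ → A → ℝ}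
    {b : A → Z} (h : IsCoordinateSystem A Z ψ b) [TotallyDisconnectedSpace Z]
    {d : A → A → ℝ} (hd : IsCompatibleMetric d) {ε : ℝ} (hε : 0 < ε) :
    ∃ (G : Finset J) (L Q : ℕ) (𝒞 : Finset (Set Z)), 0 < Q ∧ (∀ C ∈ 𝒞, IsClopen C) ∧
      ∀ (N : ℕ) (p q : A),
        (∀ u ∈ G ×ˢ Finset.Ico (-L : ℤ) (N + L), |ψ u.1 u.2 p - ψ u.1 u.2 q| < 1 / (Q : ℝ)) →
        (∀ n ∈ Finset.range N, ∀ C ∈ 𝒞, (Z.T^[n] (b p) ∈ C ↔ Z.T^[n] (b q) ∈ C)) →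
        BowenRel d A.T N ε p q := by
  classical
  obtain ⟨F, η, 𝒞, hη, h𝒞, hF⟩ := exists_finite_coords (I := J × ℤ)
    (fun i => h.continuous_coord i.1 i.2) h.continuous_base
    (fun p q h1 h2 => h.ext p q (fun j t => h1 (j, t)) h2)
    (E := fun x y => d x y < ε) (isOpen_lt hd.continuous continuous_const)
    (fun x => by rw [hd.self]; exact hε)
  obtain ⟨Q, hQ⟩ := exists_nat_one_div_lt hη
  refine ⟨F.image Prod.fst, F.sup (fun u => u.2.natAbs + 1), Q + 1, 𝒞, Nat.succ_pos _, h𝒞,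
    fun N p q h1 h2 n hn => hF _ _ (fun u hu => ?_) (fun C hC => ?_)⟩
  · rw [h.coord_iterate, h.coord_iterate]
    have hle : u.2.natAbs + 1 ≤ F.sup (fun u => u.2.natAbs + 1) :=
      Finset.le_sup (f := fun u : J × ℤ => u.2.natAbs + 1) hu
    refine (h1 (u.1, u.2 + n) ?_).trans ?_
    · rw [Finset.mem_product, Finset.mem_Ico]
      refine ⟨Finset.mem_image.2 ⟨u, hu, rfl⟩, ?_, ?_⟩ <;> dsimp only <;> omega
    · exact_mod_cast hQ
  · rw [h.base_iterate, h.base_iterate]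
    exact h2 n (Finset.mem_range.2 hn) C hC

/-- Only nonzero coordinates in the window count, since the conditions on the zero-dimensional base
are clopen and cost nothing. -/
lemma IsCoordinateSystem.exists_hasCovers {A Z : DynSystem} {J : Type*} {ψ : J → ℤ → A → ℝ}
    {b : A → Z} (h : IsCoordinateSystem A Z ψ b) [TotallyDisconnectedSpace Z]
    {d : A → A → ℝ} (hd : IsCompatibleMetric d) {ε : ℝ} (hε : 0 < ε) :
    ∃ (G : Finset J) (L : ℕ), ∀ N a : ℕ,
      (∀ p, ∃ S : Finset (J × ℤ), S.card ≤ a ∧ ∀ u ∈ G ×ˢ Finset.Ico (-L : ℤ) (N + L),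
        ψ u.1 u.2 p ≠ 0 → u ∈ S) → HasCovers (BowenRel d A.T N ε) a := by
  obtain ⟨G, L, Q, 𝒞, hQ, h𝒞, hW⟩ := h.exists_window hd hε
  refine ⟨G, L, fun N a ha => ?_⟩
  have h1 := HasCovers.of_sparse (Q := Q) (by exact_mod_cast hQ)
    (G ×ˢ Finset.Ico (-L : ℤ) (N + L)) (fun u => ψ u.1 u.2)
    (fun u _ => h.continuous_coord u.1 u.2) ha
  have h2 := HasCovers.finset_inf (E := fun (n : ℕ) (p q : A) =>
      ∀ C ∈ 𝒞, (Z.T^[n] (b p) ∈ C ↔ Z.T^[n] (b q) ∈ C)) (a := fun _ => ∑ C ∈ 𝒞, 0)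
    (Finset.range N) (fun n _ => HasCovers.finset_inf 𝒞 fun C hC => HasCovers.of_clopen
      (((h𝒞 C hC).preimage ((Z.T.continuous.iterate n).comp h.continuous_base))))
  have h3 := (h1.inf h2).mono fun p q hpq => hW N p q hpq.1 hpq.2
  simpa using h3

/-! ### Markers in free minimal zero-dimensional systems -/

namespace DynSystem

/-- The point `Tᵗ z`. -/
def move (Z : DynSystem) (t : ℤ) (z : Z) : Z := (Z.T ^ t) z

lemma move_add (Z : DynSystem) (s t : ℤ) (z : Z) : Z.move (s + t) z = Z.move s (Z.move t z) := by
  simp only [move, zpow_add, Homeomorph.mul_apply]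

lemma move_zero (Z : DynSystem) (z : Z) : Z.move 0 z = z := by
  simp only [move, zpow_zero]; rfl

lemma move_one (Z : DynSystem) (z : Z) : Z.move 1 z = Z.T z := by
  simp only [move, zpow_one]

lemma move_natCast (Z : DynSystem) (n : ℕ) (z : Z) : Z.move n z = Z.T^[n] z := by
  induction n generalizing z with
  | zero => simp [move_zero]
  | succ n ih => rw [Nat.cast_succ, move_add, ih, move_one, Function.iterate_succ_apply]

lemma continuous_move (Z : DynSystem) (t : ℤ) : Continuous (Z.move t) := (Z.T ^ t).continuous

/-- `τ` marks the starting points of the blocks of a decomposition of orbits into blocks: a point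
`z` with `τ z ≠ 0` starts a block of length `τ z`, where `n ≤ τ z ≤ M`. -/
structure IsMarker (Z : DynSystem) (n M : ℕ) (τ : Z → ℕ) : Prop where
  continuous : Continuous τ
  le : ∀ z, τ z ≤ M
  ge : ∀ z, τ z ≠ 0 → n ≤ τ z
  gap : ∀ z, ∀ i : ℤ, 0 < i → i < τ z → τ (Z.move i z) = 0
  cover : ∀ z, ∃ j : ℤ, 0 ≤ j ∧ j < τ (Z.move (-j) z)

/-- A clopen set all of whose return times are at least `n`, and which is hit by every orbit in
bounded time. -/
lemma exists_clopen_marker (Z : DynSystem) [Nonempty Z] [TotallyDisconnectedSpace Z]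
    (hfree : Z.Free) (hmin : Z.Minimal) (n : ℕ) :
    ∃ (C : Set Z) (M : ℕ), IsClopen C ∧ (∀ z ∈ C, ∀ i : ℕ, 0 < i → i < n → Z.move i z ∉ C) ∧
      ∀ z, ∃ i : ℕ, 0 < i ∧ i ≤ M ∧ Z.move i z ∈ C := by
  obtain ⟨z₀⟩ := ‹Nonempty Z›
  have hV : ∀ i : ℕ, ∃ V : Set Z, IsOpen V ∧ z₀ ∈ V ∧
      (0 < i → ∀ z ∈ V, Z.move i z ∉ V) := by
    intro i
    by_cases hi : 0 < i
    · have hne : Z.move i z₀ ≠ z₀ := by rw [move_natCast]; exact hfree z₀ i hi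
      obtain ⟨U, W, hU, hW, hzU, hzW, hd⟩ := t2_separation hne
      refine ⟨W ∩ Z.move i ⁻¹' U, hW.inter (hU.preimage (Z.continuous_move i)), ⟨hzW, hzU⟩,
        fun _ z hz hz' => ?_⟩
      exact Set.disjoint_left.1 hd hz.2 hz'.1
    · exact ⟨univ, isOpen_univ, mem_univ _, fun h => absurd h hi⟩
  choose V hVo hzV hV' using hV
  obtain ⟨C, hC, hzC, hCV⟩ := compact_exists_isClopen_in_isOpen
    (isOpen_biInter_finset (s := Finset.range n) fun i _ => hVo i)
    (mem_iInter₂.2 fun i _ => hzV i)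
  have hCV' : ∀ z ∈ C, ∀ i < n, z ∈ V i := fun z hz i hi =>
    mem_iInter₂.1 (hCV hz) i (Finset.mem_range.2 hi)
  obtain ⟨s, hs⟩ := isCompact_univ.elim_finite_subcover (fun t : ℤ => Z.move t ⁻¹' C)
    (fun t => hC.isOpen.preimage (Z.continuous_move t)) (fun z _ => by
      obtain ⟨y, ⟨t, rfl⟩, hyC⟩ := (hmin z).exists_mem_open hC.isOpen ⟨z₀, hzC⟩
      exact mem_iUnion.2 ⟨t, hyC⟩)
  -- Starting the search at time `J + 1` makes the hitting time `t + J + 1` lie between `1` and `2 *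
  -- J + 1`.
  let J := s.sup Int.natAbs
  refine ⟨C, 2 * J + 1, hC, fun z hz i hi hin hiC =>
    hV' i hi z (hCV' z hz i hin) (hCV' _ hiC i hin), fun z => ?_⟩
  obtain ⟨t, ht⟩ := mem_iUnion.1 (hs (mem_univ (Z.move (J + 1) z)))
  obtain ⟨hts, htC⟩ := mem_iUnion.1 ht
  have htJ : t.natAbs ≤ J := Finset.le_sup (f := Int.natAbs) hts
  refine ⟨(t + (J + 1)).toNat, by omega, by omega, ?_⟩
  rw [Int.toNat_of_nonneg (by omega), move_add]
  exact htC

/-- Take the first return time on a clopen marker set `C`, and `0` off `C`. Whether it equals a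
given `k` depends on finitely many translates of `C`, hence continuity. -/
lemma exists_isMarker (Z : DynSystem) [Nonempty Z] [TotallyDisconnectedSpace Z]
    (hfree : Z.Free) (hmin : Z.Minimal) (n : ℕ) :
    ∃ (M : ℕ) (τ : Z → ℕ), Z.IsMarker n M τ := by
  classical
  obtain ⟨C, M, hC, hsep, hret⟩ := Z.exists_clopen_marker hfree hmin n
  have hex : ∀ z, ∃ i : ℕ, 0 < i ∧ Z.move i z ∈ C := fun z => by
    obtain ⟨i, hi, -, hiC⟩ := hret z
    exact ⟨i, hi, hiC⟩
  let ρ : Z → ℕ := fun z => Nat.find (hex z)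
  have hρ : ∀ z, 0 < ρ z ∧ Z.move (ρ z) z ∈ C := fun z => Nat.find_spec (hex z)
  have hρmin : ∀ z (i : ℕ), 0 < i → i < ρ z → Z.move i z ∉ C := fun z i h0 hi hiC =>
    Nat.find_min (hex z) hi ⟨h0, hiC⟩
  have hρM : ∀ z, ρ z ≤ M := fun z => by
    obtain ⟨i, hi, hiM, hiC⟩ := hret z
    exact (Nat.find_min' (hex z) ⟨hi, hiC⟩).trans hiM
  have hρeq : ∀ z (k : ℕ), ρ z = k ↔ (0 < k ∧ Z.move k z ∈ C) ∧
      ∀ i ∈ Finset.range k, 0 < i → Z.move i z ∉ C := by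
    intro z k
    constructor
    · rintro rfl
      exact ⟨hρ z, fun i hi h0 => hρmin z i h0 (Finset.mem_range.1 hi)⟩
    · rintro ⟨⟨h0, hk⟩, hmin⟩
      refine le_antisymm (Nat.find_min' (hex z) ⟨h0, hk⟩) ?_
      by_contra! hlt
      exact hmin _ (Finset.mem_range.2 hlt) (hρ z).1 (hρ z).2
  have hρo : ∀ k, IsOpen {z | ρ z = k} := by
    intro k
    have : {z | ρ z = k} = {z | 0 < k ∧ Z.move k z ∈ C} ∩
        ⋂ i ∈ Finset.range k, {z | 0 < i → Z.move i z ∉ C} := by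
      ext z
      simp only [mem_inter_iff, mem_iInter]
      exact hρeq z k
    rw [this]
    refine IsOpen.inter (isOpen_const.and (hC.isOpen.preimage (Z.continuous_move k)))
      (isOpen_biInter_finset fun i _ => ?_)
    by_cases hi : 0 < i
    · simp only [hi, true_imp_iff]
      exact hC.compl.isOpen.preimage (Z.continuous_move i)
    · simp [hi]
  let τ : Z → ℕ := fun z => if z ∈ C then ρ z else 0
  have hτ1 : ∀ z ∈ C, τ z = ρ z := fun z hz => if_pos hz
  have hτ0 : ∀ z ∉ C, τ z = 0 := fun z hz => if_neg hz
  have hτC : ∀ z, τ z ≠ 0 → z ∈ C := fun z hz => by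
    by_contra h
    exact hz (hτ0 z h)
  refine ⟨M, τ, ?_, ?_, ?_, ?_, ?_⟩
  · rw [continuous_discrete_rng]
    intro k
    have : τ ⁻¹' {k} = (C ∩ {z | ρ z = k}) ∪ (Cᶜ ∩ {z | 0 = k}) := by
      ext z
      by_cases hz : z ∈ C <;> simp [τ, hz]
    rw [this]
    exact (hC.isOpen.inter (hρo k)).union (hC.compl.isOpen.inter isOpen_const)
  · intro z
    by_cases hz : z ∈ C
    · rw [hτ1 z hz]; exact hρM z
    · rw [hτ0 z hz]; exact Nat.zero_le _
  · intro z hz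
    have hzC := hτC z hz
    rw [hτ1 z hzC]
    by_contra! hlt
    exact hsep z hzC _ (hρ z).1 hlt (hρ z).2
  · intro z i h0 hi
    have hzC : z ∈ C := hτC z (by omega)
    rw [hτ1 z hzC] at hi
    apply hτ0
    have := hρmin z i.toNat (by omega) (by omega)
    rwa [Int.toNat_of_nonneg h0.le] at this
  · intro z
    have hex' : ∃ j : ℕ, Z.move (-j) z ∈ C := by
      obtain ⟨i, hi, hiM, hiC⟩ := hret (Z.move (-M) z)
      refine ⟨M - i, ?_⟩
      rw [← move_add] at hiC
      rwa [Nat.cast_sub hiM, neg_sub, sub_eq_add_neg]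
    refine ⟨Nat.find hex', by positivity, ?_⟩
    have hj := Nat.find_spec hex'
    rw [hτ1 _ hj]
    by_contra! hle
    have h1 := hρ (Z.move (-(Nat.find hex' : ℤ)) z)
    set i := ρ (Z.move (-(Nat.find hex' : ℤ)) z)
    have hle' : i ≤ Nat.find hex' := by exact_mod_cast hle
    -- If the block begun at the most recent visit to `C` ended at or before time `0`, the return to
    -- `C` at its end would be a more recent visit.
    refine Nat.find_min hex' (m := Nat.find hex' - i) (by omega) ?_
    rw [Nat.cast_sub hle', neg_sub, sub_eq_add_neg, move_add]
    exact h1.2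

/-- The blocks starting in an interval are disjoint. -/
lemma IsMarker.sum_le {Z : DynSystem} {n M : ℕ} {τ : Z → ℕ} (h : Z.IsMarker n M τ) (z : Z)
    (a : ℤ) (K : ℕ) : ∑ t ∈ Finset.Ico a (a + K), τ (Z.move t z) ≤ K + M := by
  classical
  have hdisj : ∀ s t : ℤ, s < t → Disjoint (Finset.Ico s (s + τ (Z.move s z)))
      (Finset.Ico t (t + τ (Z.move t z))) := by
    intro s t hst
    rw [Finset.disjoint_left]
    intro u hu hu'
    rw [Finset.mem_Ico] at hu hu'
    have h0 := h.gap (Z.move s z) (t - s) (by omega) (by omega)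
    rw [← move_add, sub_add_cancel] at h0
    omega
  have hpw : (↑(Finset.Ico a (a + K)) : Set ℤ).PairwiseDisjoint
      fun t => Finset.Ico t (t + τ (Z.move t z)) := by
    intro s _ t _ hst
    rcases lt_or_gt_of_ne hst with h1 | h1
    · exact hdisj s t h1
    · exact (hdisj t s h1).symm
  have hsub : (Finset.Ico a (a + K)).biUnion (fun t => Finset.Ico t (t + τ (Z.move t z))) ⊆
      Finset.Ico a (a + K + M) := by
    intro u hu
    obtain ⟨t, ht, hut⟩ := Finset.mem_biUnion.1 hu
    rw [Finset.mem_Ico] at ht hut ⊢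
    have := h.le (Z.move t z)
    omega
  have hcard := Finset.card_le_card hsub
  rw [Finset.card_biUnion hpw] at hcard
  simp only [Int.card_Ico, add_sub_cancel_left, Int.toNat_natCast] at hcard
  omega

lemma IsMarker.card_le {Z : DynSystem} {n M : ℕ} {τ : Z → ℕ} (h : Z.IsMarker n M τ) (hn : 0 < n)
    (z : Z) (a : ℤ) (K : ℕ) :
    ((Finset.Ico a (a + K)).filter fun t => τ (Z.move t z) ≠ 0).card ≤ (K + M) / n := by
  rw [Nat.le_div_iff_mul_le hn]
  refine le_trans ?_ (h.sum_le z a K)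
  rw [← smul_eq_mul, ← Finset.sum_const]
  calc ∑ _t ∈ (Finset.Ico a (a + K)).filter fun t => τ (Z.move t z) ≠ 0, n
      ≤ ∑ t ∈ (Finset.Ico a (a + K)).filter fun t => τ (Z.move t z) ≠ 0, τ (Z.move t z) :=
        Finset.sum_le_sum fun t ht => h.ge _ (Finset.mem_filter.1 ht).2
    _ ≤ _ := Finset.sum_le_sum_of_subset (Finset.filter_subset _ _)

end DynSystem

/-! ### Maps of blocks with fibres of small width dimension -/

/-- The component `g` of a map of the cube `[0,1]^ℓ` to `ℝᵐ` whose fibres have width dimension at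
most `ℓ / m` at the scale `1 / Q`. -/
noncomputable def blockVal (Q m g ℓ : ℕ) (x : ℕ → ℝ) : ℝ :=
  if ℓ = 0 ∨ m ≤ g then 0 else
    ∑ j ∈ Finset.range (ℓ / m + 1), ∏ u ∈ Finset.range ℓ,
      Real.sin ((Q * x u - gridShift (g + m * j)) * Real.pi) ^ 2

lemma continuous_blockVal (Q m g ℓ : ℕ) : Continuous (blockVal Q m g ℓ) := by
  unfold blockVal
  split_ifs
  · exact continuous_const
  · fun_prop

/-- The summands are nonnegative, and `sin²` vanishes exactly at the points of the corresponding
shifted grid. -/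
lemma blockVal_ne_zero_iff {Q m g ℓ : ℕ} (hℓ : ℓ ≠ 0) (hg : g < m) (x : ℕ → ℝ) :
    blockVal Q m g ℓ x ≠ 0 ↔ ∃ j < ℓ / m + 1, ∀ u ∈ Finset.range ℓ,
      GridRel Q (gridShift (g + m * j)) (x u) (x u) := by
  rw [blockVal, if_neg (by omega), ne_eq,
    Finset.sum_eq_zero_iff_of_nonneg fun j _ => Finset.prod_nonneg fun u _ => sq_nonneg _]
  simp only [Finset.prod_eq_zero_iff, sq_eq_zero_iff, Real.sin_eq_zero_iff, GridRel.self_iff]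
  push Not
  simp only [Finset.mem_range]
  refine exists_congr fun j => and_congr_right fun _ => forall₂_congr fun u _ =>
    forall_congr' fun v => ?_
  rw [ne_eq, mul_left_inj' Real.pi_ne_zero, eq_comm]

/-- Pigeonhole: there are `m * (ℓ / m + 1) > ℓ` grids, and each of the `ℓ` coordinates lies on at
most one, so some grid `c` is avoided. It belongs to component `c % m`. -/
lemma exists_blockVal_ne_zero {m : ℕ} (hm : 0 < m) (Q : ℕ) {ℓ : ℕ} (hℓ : ℓ ≠ 0) (x : ℕ → ℝ) :
    ∃ g < m, blockVal Q m g ℓ x ≠ 0 := by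
  classical
  have hlt : ℓ < m * (ℓ / m + 1) := Nat.lt_mul_div_succ ℓ hm
  obtain ⟨c, hc, hc'⟩ : ∃ c < m * (ℓ / m + 1), ∀ u ∈ Finset.range ℓ,
      GridRel Q (gridShift c) (x u) (x u) := by
    by_contra! hno
    obtain ⟨f, hf, hf'⟩ := exists_injOn_of_gridPoints (Q := Q) gridShift_injective gridShift_mem
      x (Finset.range ℓ) (Finset.range (m * (ℓ / m + 1))) (fun c hc hall => by
        obtain ⟨u, hu, hn⟩ := hno c (Finset.mem_range.1 hc)
        exact hn (hall u hu))
    have := Finset.card_le_card_of_injOn (s := Finset.univ) (t := Finset.range ℓ) f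
      (fun i _ => (hf' i).1) hf.injOn
    rw [Finset.card_univ, Fintype.card_coe, Finset.card_range, Finset.card_range] at this
    omega
  refine ⟨c % m, Nat.mod_lt _ hm, (blockVal_ne_zero_iff hℓ (Nat.mod_lt _ hm) x).2
    ⟨c / m, Nat.div_lt_of_lt_mul hc, ?_⟩⟩
  rwa [Nat.mod_add_div]

/-! ### The product of the full shift with a zero-dimensional system -/

section CubeProd

variable {Z : DynSystem.{u}}

/-- The coordinates on `[0,1]^ℤ × Z`. -/
def cubeCoord (t : ℤ) (p : cubeShift.prod Z) : ℝ :=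
  (Prod.fst (α := ℤ → unitInterval) (β := Z) p t : ℝ)

/-- The projection of `[0,1]^ℤ × Z` to `Z`. -/
def cubeBase (p : cubeShift.prod Z) : Z := Prod.snd (α := ℤ → unitInterval) (β := Z) p

lemma continuous_cubeCoord (t : ℤ) : Continuous (cubeCoord (Z := Z) t) :=
  continuous_subtype_val.comp ((continuous_apply t).comp continuous_fst)

lemma continuous_cubeBase : Continuous (cubeBase (Z := Z)) := continuous_snd

lemma cubeCoord_map (t : ℤ) (p : cubeShift.prod Z) :
    cubeCoord t ((cubeShift.prod Z).T p) = cubeCoord (t + 1) p := rfl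

lemma cubeBase_map (p : cubeShift.prod Z) :
    cubeBase ((cubeShift.prod Z).T p) = Z.T (cubeBase p) := rfl

lemma isCoordinateSystem_cube :
    IsCoordinateSystem (cubeShift.prod Z) Z (fun (_ : Unit) t => cubeCoord t) cubeBase where
  continuous_coord _ t := continuous_cubeCoord t
  continuous_base := continuous_cubeBase
  coord_map _ t p := cubeCoord_map t p
  base_map := cubeBase_map
  ext _ _ h1 h2 := Prod.ext (funext fun t => Subtype.ext (h1 () t)) h2

lemma mdimWith_cube_le [TotallyDisconnectedSpace Z]
    {d : cubeShift.prod Z → cubeShift.prod Z → ℝ} (hd : IsCompatibleMetric d) :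
    mdimWith d (cubeShift.prod Z).T ≤ 1 := by
  rw [← ENNReal.ofReal_one]
  refine mdimWith_le hd (cubeShift.prod Z).T.continuous fun ε hε => ?_
  obtain ⟨G, L, hGL⟩ := isCoordinateSystem_cube.exists_hasCovers hd hε
  refine ⟨2 * L, fun N => ⟨N + 2 * L, hGL N _ fun p => ⟨_, ?_, fun u hu _ => hu⟩, ?_⟩⟩
  · rw [Finset.card_product, Int.card_Ico]
    have hG : G.card ≤ 1 := Finset.card_le_one.2 fun _ _ _ _ => rfl
    calc G.card * ((N + L : ℤ) - (-L)).toNat ≤ 1 * ((N + L : ℤ) - (-L)).toNat := by gcongr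
      _ ≤ N + 2 * L := by omega
  · push_cast
    linarith

/-- The cube `[0,1]^N` embeds as the coordinates `0, …, N - 1` over a fixed point of the base space,
and closeness in the Bowen metric controls all of them, so Lebesgue's theorem gives width at least
`N`. -/
lemma one_le_mdimWith_cube [Nonempty Z]
    {d : cubeShift.prod Z → cubeShift.prod Z → ℝ} (hd : IsCompatibleMetric d) :
    1 ≤ mdimWith d (cubeShift.prod Z).T := by
  obtain ⟨z₀⟩ := ‹Nonempty Z›
  obtain ⟨ε, hε, hlt⟩ := hd.exists_lt_imp
    (E := fun p q => |cubeCoord 0 p - cubeCoord 0 q| < 1)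
    (isOpen_lt (((continuous_cubeCoord 0).comp continuous_fst).sub
      ((continuous_cubeCoord 0).comp continuous_snd)).abs continuous_const) (by simp)
  refine le_sSup_of_le ⟨ε, hε, rfl⟩ (one_le_growthRate fun N => ?_)
  have hT := (cubeShift.prod Z).T.continuous
  obtain ⟨a, ha⟩ := ENat.ne_top_iff_exists.1 (widim_ne_top hd hT hε N)
  have hcov := (widim_univ_le_iff hd hT hε).1 ha.ge
  rw [← ha]
  let ι : (Fin N → unitInterval) → cubeShift.prod Z := fun x =>
    ((fun t : ℤ => if h : 0 ≤ t ∧ t.toNat < N then x ⟨t.toNat, h.2⟩ else 0), z₀)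
  have hι : Continuous ι := by
    refine Continuous.prodMk (continuous_pi fun t => ?_) continuous_const
    split_ifs
    · exact continuous_apply _
    · exact continuous_const
  have hle : N ≤ a := by
    refine le_of_hasCovers_cube ((hcov.comap hι).mono fun x y hxy i => ?_)
    have h := hlt _ _ (hxy i i.2)
    rw [isCoordinateSystem_cube.coord_iterate () 0 i, isCoordinateSystem_cube.coord_iterate () 0 i]
      at h
    simpa [cubeCoord, ι] using h
  exact_mod_cast hle

theorem isMeanDim_cube (Z : DynSystem.{u}) [Nonempty Z] [TotallyDisconnectedSpace Z] :
    IsMeanDim (cubeShift.prod Z) 1 := by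
  obtain ⟨d, hd⟩ := exists_isCompatibleMetric (cubeShift.prod Z)
  rw [← (mdimWith_cube_le hd).antisymm (one_le_mdimWith_cube hd)]
  exact isMeanDim_mdimWith _ hd

/-! ### The factor -/

/-- The shift on sequences of reals together with the dynamics of `Z`. -/
def codeShift (Z : DynSystem.{u}) : ((ℕ × ℕ → ℤ → ℝ) × Z) ≃ₜ ((ℕ × ℕ → ℤ → ℝ) × Z) :=
  Homeomorph.prodCongr
    { toFun := fun x i t => x i (t + 1)
      invFun := fun x i t => x i (t - 1)
      left_inv := fun x => by funext i t; simp
      right_inv := fun x => by funext i t; simp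
      continuous_toFun := by fun_prop
      continuous_invFun := by fun_prop } Z.T

/-- The code of a point: for each `k`, the values of the block maps on the blocks with
marker `τ k`. -/
noncomputable def blockCode (τ : ℕ → Z → ℕ) (p : cubeShift.prod Z) : (ℕ × ℕ → ℤ → ℝ) × Z :=
  (fun i t => blockVal (i.1 + 1) (i.1 + 1) i.2 (τ i.1 (Z.move t (cubeBase p)))
    (fun u => cubeCoord (t + u) p), cubeBase p)

/-- Block lengths are locally constant, so continuity is only needed for each fixed length. -/
lemma continuous_blockCode {τ : ℕ → Z → ℕ} (hτ : ∀ k, Continuous (τ k)) :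
    Continuous (blockCode τ) := by
  refine Continuous.prodMk (continuous_pi fun i => continuous_pi fun t => ?_) continuous_cubeBase
  have h1 : Continuous fun p : ℕ × (ℕ → ℝ) => blockVal (i.1 + 1) (i.1 + 1) i.2 p.1 p.2 :=
    continuous_prod_of_discrete_left.2 fun ℓ => continuous_blockVal _ _ _ ℓ
  exact h1.comp (((hτ i.1).comp ((Z.continuous_move t).comp continuous_cubeBase)).prodMk
    (continuous_pi fun u => continuous_cubeCoord (t + u)))

lemma blockCode_map (τ : ℕ → Z → ℕ) (p : cubeShift.prod Z) :
    blockCode τ ((cubeShift.prod Z).T p) = codeShift Z (blockCode τ p) := by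
  refine Prod.ext (funext fun i => funext fun t => ?_) rfl
  change blockVal _ _ _ _ _ = blockVal _ _ _ _ _
  rw [cubeBase_map, ← DynSystem.move_one, ← DynSystem.move_add]
  congr 1
  funext u
  rw [cubeCoord_map]
  congr 1
  ring

/-- The factor of `[0,1]^ℤ × Z` formed by the codes. -/
noncomputable def codeSystem (τ : ℕ → Z → ℕ) (hτ : ∀ k, Continuous (τ k)) : DynSystem.{u} where
  carrier := range (blockCode τ)
  compact := isCompact_iff_compactSpace.1 (isCompact_range (continuous_blockCode hτ))
  T := (codeShift Z).subtype fun c => by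
    constructor
    · rintro ⟨p, rfl⟩
      exact ⟨_, blockCode_map τ p⟩
    · rintro ⟨p, hp⟩
      refine ⟨(cubeShift.prod Z).T.symm p, (codeShift Z).injective ?_⟩
      rw [← blockCode_map, Homeomorph.apply_symm_apply, hp]

/-- The factor map to the system of codes. -/
noncomputable def codeMap (τ : ℕ → Z → ℕ) (hτ : ∀ k, Continuous (τ k)) (p : cubeShift.prod Z) :
    codeSystem τ hτ := (⟨blockCode τ p, p, rfl⟩ : range (blockCode τ))

lemma isFactorMap_codeMap (τ : ℕ → Z → ℕ) (hτ : ∀ k, Continuous (τ k)) :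
    IsFactorMap (cubeShift.prod Z) (codeSystem τ hτ) (codeMap τ hτ) where
  continuous := (continuous_blockCode hτ).subtype_mk _
  surjective := by rintro ⟨_, p, rfl⟩; exact ⟨p, rfl⟩
  equivariant p := Subtype.ext (blockCode_map τ p)

/-- The coordinates on the system of codes. -/
def codeCoord {τ : ℕ → Z → ℕ} {hτ : ∀ k, Continuous (τ k)} (i : ℕ × ℕ) (t : ℤ)
    (y : codeSystem τ hτ) : ℝ := (Subtype.val (p := (· ∈ range (blockCode τ))) y).1 i t

/-- The projection of the system of codes to `Z`. -/
def codeBase {τ : ℕ → Z → ℕ} {hτ : ∀ k, Continuous (τ k)} (y : codeSystem τ hτ) : Z :=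
  (Subtype.val (p := (· ∈ range (blockCode τ))) y).2

lemma isCoordinateSystem_code (τ : ℕ → Z → ℕ) (hτ : ∀ k, Continuous (τ k)) :
    IsCoordinateSystem (codeSystem τ hτ) Z codeCoord codeBase where
  continuous_coord i t := (continuous_apply t).comp ((continuous_apply i).comp
    (continuous_fst.comp continuous_subtype_val))
  continuous_base := continuous_snd.comp continuous_subtype_val
  coord_map _ _ _ := rfl
  base_map _ := rfl
  ext _ _ h1 h2 := Subtype.ext (Prod.ext (funext fun i => funext fun t => h1 i t) h2)

/-- Sparseness of codes: they live only at block starts, and level `k` has only the components `0,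
…, k`. -/
lemma codeCoord_ne_zero {τ : ℕ → Z → ℕ} {hτ : ∀ k, Continuous (τ k)} {i : ℕ × ℕ} {t : ℤ}
    {y : codeSystem τ hτ} (h : codeCoord i t y ≠ 0) :
    i.2 < i.1 + 1 ∧ τ i.1 (Z.move t (codeBase y)) ≠ 0 := by
  obtain ⟨_, p, rfl⟩ := y
  have h' : blockVal (i.1 + 1) (i.1 + 1) i.2 (τ i.1 (Z.move t (cubeBase p)))
    (fun u => cubeCoord (t + u) p) ≠ 0 := h
  rw [blockVal] at h'
  split_ifs at h' with hc
  · exact absurd rfl h'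
  · push Not at hc
    exact ⟨hc.2, hc.1⟩

/-- The mean dimension of the system of codes is small if the markers are sparse. -/
lemma mdimWith_code_le [TotallyDisconnectedSpace Z] {τ : ℕ → Z → ℕ} {hτ : ∀ k, Continuous (τ k)}
    {n M : ℕ → ℕ} (hn : ∀ k, 0 < n k) (hmark : ∀ k, Z.IsMarker (n k) (M k) (τ k)) {c : ℝ}
    (hc : ∀ G : Finset (ℕ × ℕ), (∀ i ∈ G, i.2 < i.1 + 1) → ∑ i ∈ G, 1 / (n i.1 : ℝ) ≤ c)
    {d : codeSystem τ hτ → codeSystem τ hτ → ℝ} (hd : IsCompatibleMetric d) :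
    mdimWith d (codeSystem τ hτ).T ≤ ENNReal.ofReal c := by
  classical
  refine mdimWith_le hd (codeSystem τ hτ).T.continuous fun ε hε => ?_
  obtain ⟨G, L, hGL⟩ := (isCoordinateSystem_code τ hτ).exists_hasCovers hd hε
  set G' := G.filter fun i => i.2 < i.1 + 1 with hG'
  refine ⟨∑ i ∈ G', ((2 * L + M i.1 : ℕ) : ℝ) / n i.1, fun N =>
    ⟨∑ i ∈ G', (N + 2 * L + M i.1) / n i.1, hGL N _ fun y => ?_, ?_⟩⟩
  · refine ⟨G'.biUnion fun i => ((Finset.Ico (-L : ℤ) (N + L)).filter fun t =>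
      τ i.1 (Z.move t (codeBase y)) ≠ 0).image fun t => (i, t), ?_, ?_⟩
    · refine Finset.card_biUnion_le.trans (Finset.sum_le_sum fun i _ => ?_)
      refine Finset.card_image_le.trans ?_
      have := (hmark i.1).card_le (hn i.1) (codeBase y) (-L) (N + 2 * L)
      rwa [show (-L : ℤ) + (N + 2 * L : ℕ) = N + L by push_cast; ring] at this
    · intro w hw hne
      obtain ⟨h1, h2⟩ := codeCoord_ne_zero hne
      rw [Finset.mem_product] at hw
      refine Finset.mem_biUnion.2 ⟨w.1, Finset.mem_filter.2 ⟨hw.1, h1⟩,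
        Finset.mem_image.2 ⟨w.2, Finset.mem_filter.2 ⟨hw.2, h2⟩, rfl⟩⟩
  · have hsum : ((∑ i ∈ G', (N + 2 * L + M i.1) / n i.1 : ℕ) : ℝ) ≤
        (∑ i ∈ G', 1 / (n i.1 : ℝ)) * N + ∑ i ∈ G', ((2 * L + M i.1 : ℕ) : ℝ) / n i.1 := by
      rw [Nat.cast_sum, Finset.sum_mul, ← Finset.sum_add_distrib]
      refine Finset.sum_le_sum fun i _ => Nat.cast_div_le.trans (le_of_eq ?_)
      push_cast
      ring
    refine hsum.trans ?_
    have := hc G' fun i hi => (Finset.mem_filter.1 hi).2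
    gcongr

/-- On a fibre of the code map, the coordinates in a block of length `ℓ` contribute
at most `ℓ / (k + 1)` to the width dimension at the scale `1 / (k + 1)`. -/
lemma hasCovers_block {τ : ℕ → Z → ℕ} (hτ : ∀ k, Continuous (τ k)) (p₀ : cubeShift.prod Z)
    (k : ℕ) (t : ℤ) :
    HasCovers (fun p q : codeMap τ hτ ⁻¹' {codeMap τ hτ p₀} =>
      ∀ u ∈ Finset.range (τ k (Z.move t (cubeBase p₀))),
        |cubeCoord (t + u) (p : cubeShift.prod Z) - cubeCoord (t + u) (q : cubeShift.prod Z)| <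
          1 / ((k + 1 : ℕ) : ℝ))
      (τ k (Z.move t (cubeBase p₀)) / (k + 1)) := by
  have hclosed : IsClosed (codeMap τ hτ ⁻¹' {codeMap τ hτ p₀}) :=
    isClosed_singleton.preimage (isFactorMap_codeMap τ hτ).continuous
  have hcpt : CompactSpace (codeMap τ hτ ⁻¹' {codeMap τ hτ p₀}) :=
    isCompact_iff_compactSpace.1 hclosed.isCompact
  set ℓ := τ k (Z.move t (cubeBase p₀)) with hℓ
  by_cases h0 : ℓ = 0
  · rw [h0, Nat.zero_div]
    exact HasCovers.top.mono fun p q _ => by simp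
  -- A component that is nonzero at `p₀` keeps its value on the whole fibre, so at each point one of
  -- the `ℓ / (k + 1) + 1` grids dealt to `g` misses the block.
  obtain ⟨g, hg, hne⟩ := exists_blockVal_ne_zero (Nat.succ_pos k) (k + 1) h0
    (fun u => cubeCoord (t + u) p₀)
  have hcont : ∀ u : ℕ, Continuous fun p : codeMap τ hτ ⁻¹' {codeMap τ hτ p₀} =>
      cubeCoord (t + u) (p : cubeShift.prod Z) :=
    fun u => (continuous_cubeCoord _).comp continuous_subtype_val
  refine HasCover.hasCovers ?_ ⟨fun j p q => ∀ u ∈ Finset.range ℓ,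
    GridRel ((k + 1 : ℕ) : ℝ) (gridShift (g + (k + 1) * j)) (cubeCoord (t + u) p.1)
      (cubeCoord (t + u) q.1),
    fun j => isOpenPER_gridRel (by positivity) _ _ _ fun u _ => hcont u, fun p => ?_⟩
  · simp only [ofPred_forall]
    refine isOpen_biInter_finset fun u _ => isOpen_lt ?_ continuous_const
    exact (((hcont u).comp continuous_fst).sub ((hcont u).comp continuous_snd)).abs
  · have hcode : blockCode τ p.1 = blockCode τ p₀ := congrArg Subtype.val p.2
    have hval := congrFun (congrFun (congrArg Prod.fst hcode) (k, g)) t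
    have hbase : cubeBase p.1 = cubeBase p₀ :=
      congrArg (fun c : (ℕ × ℕ → ℤ → ℝ) × Z => c.2) hcode
    change blockVal _ _ _ _ _ = blockVal _ _ _ _ _ at hval
    rw [hbase] at hval
    have hne' : blockVal (k + 1) (k + 1) g ℓ (fun u => cubeCoord (t + u) p.1) ≠ 0 := by
      rw [hval]
      exact hne
    obtain ⟨j, hj, hj'⟩ := (blockVal_ne_zero_iff h0 hg _).1 hne'
    exact ⟨⟨j, hj⟩, hj'⟩

lemma isRelMeanDim_codeMap [TotallyDisconnectedSpace Z] {τ : ℕ → Z → ℕ}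
    (hτ : ∀ k, Continuous (τ k)) {n M : ℕ → ℕ} (hmark : ∀ k, Z.IsMarker (n k) (M k) (τ k)) :
    IsRelMeanDim (cubeShift.prod Z) (codeSystem τ hτ) (codeMap τ hτ) 0 := by
  refine isRelMeanDim_zero (isFactorMap_codeMap τ hτ).continuous fun d hd ε hε c hc => ?_
  obtain ⟨G, L, Q, 𝒞, hQ, -, hW⟩ := isCoordinateSystem_cube.exists_window hd hε
  obtain ⟨k', hk'⟩ := exists_nat_one_div_lt hc
  -- One level serves both purposes: its scale `1 / (k + 1)` is at most `1 / Q`, and its rate `1 /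
  -- (k + 1)` is at most `c`.
  obtain ⟨k, hkQ, hkk'⟩ : ∃ k, Q ≤ k + 1 ∧ k' ≤ k := ⟨Q + k', by omega, by omega⟩
  have hkc : 1 / ((k + 1 : ℕ) : ℝ) ≤ c := by
    refine le_trans ?_ hk'.le
    push_cast
    gcongr
  refine ⟨((2 * L + 2 * M k : ℕ) : ℝ) / (k + 1 : ℕ), fun N =>
    ⟨(N + 2 * L + 2 * M k) / (k + 1), ?_, fun y => ?_⟩⟩
  · refine Nat.cast_div_le.trans ?_
    calc ((N + 2 * L + 2 * M k : ℕ) : ℝ) / (k + 1 : ℕ)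
        = 1 / ((k + 1 : ℕ) : ℝ) * N + ((2 * L + 2 * M k : ℕ) : ℝ) / (k + 1 : ℕ) := by
          push_cast; ring
      _ ≤ _ := by gcongr
  · obtain ⟨p₀, rfl⟩ := (isFactorMap_codeMap τ hτ).surjective y
    -- Block starts are collected from `M k` steps before the window, since the block containing its
    -- left end may begin earlier. Together with the overhang on the right this gives the term `2 *
    -- M k`.
    have hcov := HasCovers.finset_inf (Finset.Ico (-(L : ℤ) - M k) (N + L))
      fun t _ => hasCovers_block hτ p₀ k t
    refine (hcov.mono_right ?_).mono fun p q hpq => ?_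
    · rw [Nat.le_div_iff_mul_le (Nat.succ_pos k), Finset.sum_mul]
      refine (Finset.sum_le_sum fun t _ => Nat.div_mul_le_self _ _).trans ?_
      have := (hmark k).sum_le (cubeBase p₀) (-(L : ℤ) - M k) (N + 2 * L + M k)
      rw [show (-(L : ℤ) - M k) + (N + 2 * L + M k : ℕ) = N + L by push_cast; ring] at this
      omega
    · have hbase : ∀ p : codeMap τ hτ ⁻¹' {codeMap τ hτ p₀}, cubeBase p.1 = cubeBase p₀ :=
        fun p => congrArg (fun y : range (blockCode τ) => y.1.2) p.2
      refine hW N p q (fun w hw => ?_) (fun n _ C _ => by rw [hbase p, hbase q])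
      obtain ⟨j, hj0, hj⟩ := (hmark k).cover (Z.move w.2 (cubeBase p₀))
      rw [← DynSystem.move_add] at hj
      have hjM := (hmark k).le (Z.move (-j + w.2) (cubeBase p₀))
      have hw2 := Finset.mem_Ico.1 (Finset.mem_product.1 hw).2
      have := hpq (-j + w.2) (Finset.mem_Ico.2 ⟨by omega, by omega⟩) j.toNat
        (Finset.mem_range.2 (by omega))
      rw [Int.toNat_of_nonneg hj0, neg_add_cancel_comm] at this
      refine this.trans_le ?_
      gcongr

theorem exists_factor (Z : DynSystem.{u}) [Nonempty Z] [TotallyDisconnectedSpace Z]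
    (hfree : Z.Free) (hmin : Z.Minimal) {δ : ℝ} (hδ : 0 < δ) :
    ∃ (Y : DynSystem.{u}) (π : cubeShift.prod Z → Y), IsFactorMap (cubeShift.prod Z) Y π ∧
      (∃ b < ENNReal.ofReal δ, IsMeanDim Y b) ∧ IsRelMeanDim (cubeShift.prod Z) Y π 0 := by
  -- Summable weights on all pairs `(k, g)` with total at most `δ / 2`; the block length `n k` is
  -- taken so large that `1 / n k` is below the weights of all `g ≤ k`.
  obtain ⟨w, hw, s, hs, hsδ⟩ := posSumOfEncodable (half_pos hδ) (ℕ × ℕ)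
  have hex : ∀ k : ℕ, ∃ n : ℕ, 0 < n ∧ ∀ g ∈ Finset.range (k + 1), 1 / (n : ℝ) ≤ w (k, g) := by
    intro k
    have h1 : ∀ g ∈ Finset.range (k + 1), ∀ᶠ n : ℕ in atTop, 1 / (n : ℝ) ≤ w (k, g) :=
      fun g _ => (tendsto_one_div_atTop_nhds_zero_nat.eventually_lt_const (hw (k, g))).mono
        fun n hn => hn.le
    exact ((eventually_gt_atTop 0).and ((Finset.eventually_all _).2 h1)).exists
  choose n hn hnw using hex
  choose M τ hmark using fun k => Z.exists_isMarker hfree hmin (n k)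
  have hτ : ∀ k, Continuous (τ k) := fun k => (hmark k).continuous
  obtain ⟨d, hd⟩ := exists_isCompatibleMetric (codeSystem τ hτ)
  refine ⟨codeSystem τ hτ, codeMap τ hτ, isFactorMap_codeMap τ hτ,
    ⟨mdimWith d (codeSystem τ hτ).T, ?_, isMeanDim_mdimWith _ hd⟩,
    isRelMeanDim_codeMap hτ hmark⟩
  refine (mdimWith_code_le hn hmark (c := δ / 2) (fun G hG => ?_) hd).trans_lt
    ((ENNReal.ofReal_lt_ofReal_iff hδ).2 (half_lt_self hδ))
  calc ∑ i ∈ G, 1 / (n i.1 : ℝ) ≤ ∑ i ∈ G, w i :=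
        Finset.sum_le_sum fun i hi => hnw i.1 i.2 (Finset.mem_range.2 (hG i hi))
    _ ≤ s := sum_le_hasSum G (fun i _ => (hw i).le) hs
    _ ≤ δ / 2 := hsδ

end CubeProd

/-! ### The odometer -/

/-- The dyadic odometer. -/
noncomputable def odometer : DynSystem.{0} where
  carrier := ℤ_[2]
  T := Homeomorph.addRight 1

lemma addRight_one_iterate (n : ℕ) (x : ℤ_[2]) :
    (Homeomorph.addRight (1 : ℤ_[2]))^[n] x = x + n := by
  induction n with
  | zero => simp
  | succ n ih => rw [Function.iterate_succ_apply', ih]; simp [add_assoc]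

lemma addRight_one_zpow (n : ℤ) (x : ℤ_[2]) :
    (Homeomorph.addRight (1 : ℤ_[2]) ^ n) x = x + n := by
  induction n using Int.induction_on generalizing x with
  | zero => simp
  | succ n ih =>
    rw [zpow_add_one, Homeomorph.mul_apply, ih, Homeomorph.coe_addRight]
    push_cast
    ring
  | pred n ih =>
    rw [zpow_sub_one, Homeomorph.mul_apply, ih]
    change x + -1 + _ = _
    push_cast
    ring

lemma odometer_free : odometer.Free := by
  intro x n hn h
  have h' : (n : ℤ_[2]) = 0 := add_eq_left.1 ((addRight_one_iterate n x).symm.trans h)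
  exact hn.ne' (by exact_mod_cast h')

lemma denseRange_addRight_one_zpow (x : ℤ_[2]) :
    DenseRange fun k : ℤ => (Homeomorph.addRight (1 : ℤ_[2]) ^ k) x := by
  simp only [addRight_one_zpow]
  exact (Homeomorph.addLeft x).surjective.denseRange.comp
    PadicInt.denseRange_intCast (Homeomorph.addLeft x).continuous

lemma odometer_minimal : odometer.Minimal := fun x => denseRange_addRight_one_zpow x

/-! ### The main theorem -/

theorem theorem1p2 :
    -- for every `δ > 0`: a factor map with `mdim X = 1`, `mdim Y < δ`, `mdim π = 0`
    (∀ δ : ℝ, 0 < δ → ∃ (X Y : DynSystem.{0}) (π : X → Y), IsFactorMap X Y π ∧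
      IsMeanDim X 1 ∧ (∃ b < ENNReal.ofReal δ, IsMeanDim Y b) ∧ IsRelMeanDim X Y π 0) ∧
    -- for every nonempty free minimal zero-dimensional `Z`, one may take `X = [0,1]^ℤ × Z`
    (∀ Z : DynSystem.{u}, Nonempty Z → TotallyDisconnectedSpace Z → Z.Free → Z.Minimal →
      IsMeanDim (cubeShift.prod Z) 1 ∧
      ∀ δ : ℝ, 0 < δ → ∃ (Y : DynSystem.{u}) (π : cubeShift.prod Z → Y),
        IsFactorMap (cubeShift.prod Z) Y π ∧
        (∃ b < ENNReal.ofReal δ, IsMeanDim Y b) ∧ IsRelMeanDim (cubeShift.prod Z) Y π 0) ∧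
    -- the Hurewicz-type inequality fails in general
    ¬ (∀ (X Y : DynSystem.{0}) (π : X → Y), IsFactorMap X Y π → ∀ a b c : ℝ≥0∞,
      IsMeanDim X a → IsMeanDim Y b → IsRelMeanDim X Y π c → a ≤ b + c) := by
  have h2 : ∀ Z : DynSystem.{u}, Nonempty Z → TotallyDisconnectedSpace Z → Z.Free → Z.Minimal →
      IsMeanDim (cubeShift.prod Z) 1 ∧
      ∀ δ : ℝ, 0 < δ → ∃ (Y : DynSystem.{u}) (π : cubeShift.prod Z → Y),
        IsFactorMap (cubeShift.prod Z) Y π ∧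
        (∃ b < ENNReal.ofReal δ, IsMeanDim Y b) ∧ IsRelMeanDim (cubeShift.prod Z) Y π 0 :=
    fun Z _ _ hfree hmin => ⟨isMeanDim_cube Z, fun δ hδ => exists_factor Z hfree hmin hδ⟩
  have h1 : ∀ δ : ℝ, 0 < δ → ∃ (X Y : DynSystem.{0}) (π : X → Y), IsFactorMap X Y π ∧
      IsMeanDim X 1 ∧ (∃ b < ENNReal.ofReal δ, IsMeanDim Y b) ∧ IsRelMeanDim X Y π 0 := by
    intro δ hδ
    have hne : Nonempty odometer := ⟨(0 : ℤ_[2])⟩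
    have htd : TotallyDisconnectedSpace odometer :=
      inferInstanceAs (TotallyDisconnectedSpace ℤ_[2])
    obtain ⟨Y, π, hπ, hY, hrel⟩ := exists_factor odometer odometer_free odometer_minimal hδ
    exact ⟨cubeShift.prod odometer, Y, π, hπ, isMeanDim_cube odometer, hY, hrel⟩
  refine ⟨h1, h2, fun h => ?_⟩
  -- With `δ = 1` the inequality would read `1 ≤ b + 0` with `b < 1`.
  obtain ⟨X, Y, π, hπ, hX, ⟨b, hb, hY⟩, hrel⟩ := h1 1 one_pos
  have := h X Y π hπ 1 b 0 hX hY hrel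
  rw [add_zero] at this
  rw [ENNReal.ofReal_one] at hb
  exact absurd this (not_le.2 hb)
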